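/- **Model.** Let $\mathcal V$ be a finite set of nodes, $\Delta t>0$, $a_{n,i},b_{ij}\in\mathbb C$. The generative model $\sum_{n}a_{n,i}\frac{d^n x_i}{dt^n}=\sum_{j\ne i}b_{ij}x_j+p_i$ is discretised by the bilinear transform, giving $$x_i(k)=\sum_{j\neq i}(h_{ij}*x_j)(k)+e_i(k),\quad k\in\mathbb Z,\qquad \mathsf h_{ij}(z)=\frac{b_{ij}}{\mathsf S_i(z)},\qquad \mathsf S_i(z)=\sum_{n}a_{n,i}\Big(\tfrac{2(1-z^{-1})}{\Delta t(1+z^{-1})}\Big)^n ,$$ where $h_{ij}(n)$, $n\in\mathbb Z$, is the inverse $z$-transform of $\mathsf h_{ij}$. All poles of the filters $1/\mathsf S_i(z)$ lie in $|z|<1$. The inputs $e_i$ are square integrable, zero-mean and mutually uncorrelated, $e_i$ being wide-sense cyclostationary of (least) period $T_i$; $T=\mathrm{LCM}\{T_i\}$. The output $x$ has bounded second moments. Write $X_i(k)=[x_i(kT),\dots,x_i(kT+T-1)]'$, and $E_i$ likewise, for the lifted processes and $X,E$ for the stacked ones; for $Y\in\{X,E\}$ let $R_Y(n)=\mathbb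 E[Y(n)Y(0)^*]$ and $\Phi_Y(\omega)=\sum_{n}R_Y(n)e^{-\iota\omega n}$. The series defining $\Phi_E$ converges absolutely. The lifted transfer matrix $\mathbb H(\omega)=\sum_n H[n]e^{-\iota\omega n}$ has entries $H_{ij,pt}[n]=h_{ij}(nT+p-t)$, $0\le p,t<T$. The model is *well-posed*: $I-\mathbb H(\omega)$ is invertible for all $\omega$; and *topologically detectable*: $\Phi_{E_i}(\omega)\succ0$ for all $i$ and $\omega\in[0,2\pi)$. Node $k$ is a *child* of $i$ (and $i$ a *parent* of $k$) if $\mathsf h_{ki}\ne0$. Distinct nodes are *adjacent* if one is a child of the other, and *strict spouses* if they have a common child and are not adjacent. We say that the eigenvalues of $B_j'\Phi_X^{-1}(\omega)B_i$ (the $T\times T$ block $(j,i)$ of $\Phi_X^{-1}(\omega)$) *have constant phase* if there is a $c_{ji}\in\mathbb R$ such that for all $\omega\in[0,2\pi)$ every eigenvalue of this block is of the form $\varrho e^{\iota c_{ji}}$ with $\varrho\ge0$, and not all eigenvalues, over all $\omega\in[0,2\pi)$, are zero. **Theorem.** Assume that for every node $i$ all outgoing weights $b_{ki}$ ($k$ a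 child of $i$) have the same phase. Then: 1. The series defining $\Phi_X$ converges absolutely, $\Phi_X(\omega)$ is invertible for every $\omega$, and if $i,j$ are strict spouses, then the eigenvalues of $B_j'\Phi_X^{-1}(\omega)B_i$ have constant phase, and for all but finitely many $\omega\in[0,2\pi)$ none of them is zero. 2. Suppose moreover that every node is genuinely dynamic, i.e. for each $i$ some $a_{n,i}$ with $n\ge1$ is nonzero. Let $i\neq j$, and fix the graph, the $a_{n,i}$, the input $e$, the phases of all weights and all weights other than $b_{ij},b_{ji}$. Then for all magnitudes of those of $b_{ij},b_{ji}$ that are nonzero, except for a set of Lebesgue measure zero, and whenever the resulting model is well-posed: the eigenvalues of $B_j'\Phi_X^{-1}(\omega)B_i$ have constant phase if and only if $i$ and $j$ are strict spouses. (If $i,j$ are not adjacent, neither weight is present and there is no exceptional set.) -/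

import Mathlib

open MeasureTheory Set
open scoped ComplexConjugate Real ComplexOrder

noncomputable section

/-- The parameters of the generative model
`∑ₙ a_{n,i} dⁿxᵢ/dtⁿ = ∑_{j ≠ i} b_{ij} x_j + p_i`, discretised with sampling period `dt`.
`(a i).coeff n` is `a_{n,i}` and `b i j` is the weight of the edge from `j` to `i`
(the diagonal of `b` is never used). -/
structure LDM (V : Type*) where
  a : V → Polynomial ℂ
  dt : ℝ
  dt_pos : 0 < dt
  b : V → V → ℂ

namespace LDM

variable {V : Type*} (M : LDM V)

/-- `S_i(z) = ∑ₙ a_{n,i} (2 (1 - z⁻¹) / (dt (1 + z⁻¹)))ⁿ` (bilinear transform), for `z ≠ 0, -1`. -/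
def S (i : V) (z : ℂ) : ℂ :=
  (M.a i).eval (2 * (1 - z⁻¹) / (M.dt * (1 + z⁻¹)))

/-- With `d = deg a_i`, the polynomial `(1 + q)^d S_i(q⁻¹)` in the delay variable `q = z⁻¹`. -/
def den (i : V) (q : ℂ) : ℂ :=
  ∑ n ∈ Finset.range ((M.a i).natDegree + 1),
    (M.a i).coeff n * (2 / (M.dt : ℂ)) ^ n * (1 - q) ^ n * (1 + q) ^ ((M.a i).natDegree - n)

/-- The rational function `1 / S_i(z)` with its value at the removable point `z = -1`
(see `invS_eq`). -/
def invS (i : V) (z : ℂ) : ℂ := (1 + z⁻¹) ^ (M.a i).natDegree / M.den i z⁻¹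

theorem invS_eq (i : V) (z : ℂ) (hz : 1 + z⁻¹ ≠ 0) : M.invS i z = (M.S i z)⁻¹ := by
  have hdt : (M.dt : ℂ) ≠ 0 := by exact_mod_cast M.dt_pos.ne'
  have hden : M.den i z⁻¹ = (1 + z⁻¹) ^ (M.a i).natDegree * M.S i z := by
    unfold den S
    rw [Polynomial.eval_eq_sum_range, Finset.mul_sum]
    refine Finset.sum_congr rfl fun n hn => ?_
    have hn' : n ≤ (M.a i).natDegree := by
      have := Finset.mem_range.mp hn
      omega
    have hpow : (1 + z⁻¹) ^ (M.a i).natDegree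
        = (1 + z⁻¹) ^ ((M.a i).natDegree - n) * (1 + z⁻¹) ^ n := by
      rw [← pow_add, Nat.sub_add_cancel hn']
    have h2 : (2 * (1 - z⁻¹) / (M.dt * (1 + z⁻¹))) ^ n * (1 + z⁻¹) ^ n
        = (2 / (M.dt : ℂ)) ^ n * (1 - z⁻¹) ^ n := by
      rw [← mul_pow, ← mul_pow]
      congr 1
      generalize z⁻¹ = q at hz
      field_simp
    rw [hpow]
    linear_combination (-(M.a i).coeff n * (1 + z⁻¹) ^ ((M.a i).natDegree - n)) * h2
  unfold invS
  rw [hden, div_mul_eq_div_div, div_self (pow_ne_zero _ hz), one_div]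

/-- The filters `1 / S_i` are causal and stable: all their poles lie in `|z| < 1`. -/
def IsStable : Prop := ∀ (i : V) (q : ℂ), ‖q‖ ≤ 1 → M.den i q ≠ 0

variable [DecidableEq V]

/-- The transfer function `h_{ij}(z) = b_{ij} / S_i(z)`, with `h_{ii} = 0`. -/
def h (i j : V) (z : ℂ) : ℂ := if i = j then 0 else M.b i j * M.invS i z

/-- Inverse `z`-transform of `h_{ij}`. -/
def impulse (i j : V) (n : ℤ) : ℂ :=
  (2 * (π : ℂ) * Complex.I)⁻¹ * ∮ z in C(0, 1), z ^ (n - 1) * M.h i j z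

/-- `(i, j)` is an edge of the linear dynamic graph (directed from `j` to `i`). -/
def Edge (i j : V) : Prop := M.h i j ≠ 0

/-- Children of `i`. -/
def children (i : V) : Set V := {k | M.Edge k i}

/-- Parents of `i`. -/
def parents (i : V) : Set V := {k | M.Edge i k}

/-- One-hop neighbours of `i` in the undirected topology. -/
def neighbors (i : V) : Set V := M.children i ∪ M.parents i

/-- `i` and `j` are strict spouses: they are distinct, have a common child, and are not adjacent
in the topology. -/
def StrictSpouses (i j : V) : Prop :=
  i ≠ j ∧ (∃ k ∈ M.children i, j ∈ M.parents k) ∧ i ∉ M.neighbors j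

/-- All outgoing edge weights of any given node have the same phase. -/
def SameOutgoingPhase : Prop :=
  ∀ i, ∀ k₁ ∈ M.children i, ∀ k₂ ∈ M.children i, (M.b k₁ i).arg = (M.b k₂ i).arg

/-- The lifted transfer matrix `ℍ(ω) = ∑ₐ H[a] e^{-iωa}`, where
`H_{ij,pt}[a] = h_{ij}(aT + p - t)`. -/
def liftedTransfer (T : ℕ) (ω : ℝ) : Matrix (V × Fin T) (V × Fin T) ℂ :=
  fun u w => ∑' n : ℤ,
    M.impulse u.1 w.1 (n * T + (u.2 : ℕ) - (w.2 : ℕ)) * Complex.exp (-(Complex.I * ω * n))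

/-- `I - ℍ` is invertible at every frequency. -/
def WellPosed [Fintype V] (T : ℕ) : Prop := ∀ ω : ℝ, IsUnit (1 - M.liftedTransfer T ω)

/-- `x` is the output of the model driven by the input `e`: a family of processes with bounded
second moments such that `x_i(k) = ∑_j (h_{ij} * x_j)(k) + e_i(k)`. -/
structure IsOutput [Fintype V] {Ω : Type*} [MeasurableSpace Ω] (P : Measure Ω)
    (e x : V → ℤ → Ω → ℂ) : Prop where
  memLp : ∀ i k, MemLp (x i k) 2 P
  bounded : ∃ C : ℝ, ∀ i k, ∫ s, ‖x i k s‖ ^ 2 ∂P ≤ C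
  dynamics : ∀ i k, ∀ᵐ s ∂P,
    HasSum (fun n : ℤ => ∑ j, M.impulse i j n * x j (k - n) s) (x i k s - e i k s)

/-- The model obtained by giving the weights `b_{ij}` and `b_{ji}` the magnitudes `r` and `s`,
keeping their phases; an absent edge (weight `0`) stays absent. -/
def setMagnitudes (i j : V) (r s : ℝ) : LDM V where
  a := M.a
  dt := M.dt
  dt_pos := M.dt_pos
  b := fun k l =>
    if k = i ∧ l = j then r * (M.b i j / ‖M.b i j‖)
    else if k = j ∧ l = i then s * (M.b j i / ‖M.b j i‖)
    else M.b k l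

end LDM

section Processes

variable {V Ω : Type*} [MeasurableSpace Ω] (P : Measure Ω)

/-- Mean and autocorrelation of the process `y` are invariant under the time shift `T`. -/
def HasPeriod (y : ℤ → Ω → ℂ) (T : ℕ) : Prop :=
  (∀ t, ∫ ξ, y (t + T) ξ ∂P = ∫ ξ, y t ξ ∂P) ∧
  ∀ s t, ∫ ξ, y (s + T) ξ * conj (y (t + T) ξ) ∂P = ∫ ξ, y s ξ * conj (y t ξ) ∂P

/-- Wide sense cyclostationary process of period `T` (the least period). -/
structure IsWSCS (y : ℤ → Ω → ℂ) (T : ℕ) : Prop where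
  memLp : ∀ k, MemLp (y k) 2 P
  pos : 0 < T
  period : HasPeriod P y T
  least : ∀ T', 0 < T' → HasPeriod P y T' → T ≤ T'

/-- Zero mean, mutually uncorrelated exogenous inputs, `e_i` being cyclostationary of period
`τ i`. -/
structure IsExogenousInput (τ : V → ℕ) (e : V → ℤ → Ω → ℂ) : Prop where
  wscs : ∀ i, IsWSCS P (e i) (τ i)
  mean_zero : ∀ i k, ∫ ξ, e i k ξ ∂P = 0
  uncorrelated : ∀ i j, i ≠ j → ∀ s t, ∫ ξ, e i s ξ * conj (e j t ξ) ∂P = 0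

/-- The lifted process `Y_i(k) = [y_i(kT), …, y_i(kT+T-1)]'`, all `i` stacked. -/
def lifted (T : ℕ) (y : V → ℤ → Ω → ℂ) (k : ℤ) (u : V × Fin T) : Ω → ℂ :=
  y u.1 (k * T + (u.2 : ℕ))

/-- `R_Y(n) = E[Y(n) Y(0)^*]` for the lifted process `Y`. -/
def autocorr (T : ℕ) (y : V → ℤ → Ω → ℂ) (n : ℤ) : Matrix (V × Fin T) (V × Fin T) ℂ :=
  fun u w => ∫ ξ, lifted T y n u ξ * conj (lifted T y 0 w ξ) ∂P

/-- The autocorrelation of the lifted process is absolutely summable, so that its power spectral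
density is given by a convergent series. -/
def HasPSD (T : ℕ) (y : V → ℤ → Ω → ℂ) : Prop :=
  ∀ u w, Summable fun n : ℤ => autocorr P T y n u w

/-- Power spectral density `Φ_Y(ω) = ∑ₙ R_Y(n) e^{-iωn}` of the lifted process. -/
def psd (T : ℕ) (y : V → ℤ → Ω → ℂ) (ω : ℝ) : Matrix (V × Fin T) (V × Fin T) ℂ :=
  fun u w => ∑' n : ℤ, autocorr P T y n u w * Complex.exp (-(Complex.I * ω * n))

/-- The `T × T` block `(j, i)`, that is `B_j' A B_i`. -/
def block {T : ℕ} (A : Matrix (V × Fin T) (V × Fin T) ℂ) (j i : V) :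
    Matrix (Fin T) (Fin T) ℂ :=
  fun p r => A (j, p) (i, r)

/-- `Φ_{E_i}(ω) ≻ 0` for all `i` and `ω`. -/
def TopologicallyDetectable (T : ℕ) (e : V → ℤ → Ω → ℂ) : Prop :=
  ∀ i, ∀ ω ∈ Ico (0 : ℝ) (2 * π), (block (psd P T e ω) i i).PosDef

end Processes

/-- All eigenvalues of `A ω`, `ω ∈ [0, 2π)`, that have a phase (that are not zero) have the same
phase `c`, and there is at least one such eigenvalue. -/
def HasConstantPhase {T : ℕ} (A : ℝ → Matrix (Fin T) (Fin T) ℂ) (c : ℝ) : Prop :=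
  (∀ ω ∈ Ico (0 : ℝ) (2 * π), ∀ μ ∈ spectrum ℂ (A ω), μ = ‖μ‖ * Complex.exp (c * Complex.I)) ∧
  ∃ ω ∈ Ico (0 : ℝ) (2 * π), ∃ μ ∈ spectrum ℂ (A ω), μ ≠ 0

end

/-! Write L_k for the lifted filter of 1/S_k. Lifting turns the dynamics into a stationary equation
X = H ⋆ X + E in L². By stability the entries of H(ω), hence by well-posedness those of (I -
H(ω))⁻¹, are C² and periodic, so the inverse has an absolutely summable kernel and Φ_X = (I - H)⁻¹
Φ_E (I - H)⁻* (`IsOutput.psd_eq`). Uncorrelated inputs make Φ_E block diagonal. Inverting, block (j,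
i) of Φ_X⁻¹ = (I - H)* Φ_E⁻¹ (I - H) is -conj(b_ij) L_i* Φ_{E_i}⁻¹ - b_ji Φ_{E_j}⁻¹ L_j + ∑_k
conj(b_kj) b_ki L_k* Φ_{E_k}⁻¹ L_k, with k ≠ i, j (`IsOutput.block_psd_inv`).

For strict spouses the first two terms vanish, and all nonzero coefficients in the sum share one
phase. The block is then a phase times a positive semidefinite matrix, definite wherever det L_k ≠ 0
for one common child k. That determinant is a product of values of 1/S_k on the unit circle, where
1/S_k can vanish only at -1, so it vanishes at finitely many ω. For nodes neither adjacent nor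
strict spouses the block is zero.

For adjacent nodes, constant phase would make det(block ω₁) · conj(det(block ω₂)) real for all ω₁,
ω₂. As a polynomial in the magnitude of b_ij (or b_ji) its imaginary part has top coefficient a
nonzero multiple of the imaginary part of a product of the same kind for det L_i (or det L_j). This
is nonzero for some ω₁, ω₂ (`exists_im_det_liftedFilter_ne_zero`): otherwise a holomorphic function
on the closed disc would be real on the circle, hence constant there, although it vanishes at -1 and
not everywhere. Fubini then gives a null exceptional set. -/

noncomputable section

/-! ### Absolutely convergent Fourier series -/

/-- The discrete time Fourier transform of the sequence `c`. -/
def dtft (c : ℤ → ℂ) (ω : ℝ) : ℂ := ∑' n : ℤ, c n * Complex.exp (-(Complex.I * ω * n))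

/-- The inverse discrete time Fourier transform. -/
def dtftCoeff (f : ℝ → ℂ) (n : ℤ) : ℂ :=
  (2 * (π : ℂ))⁻¹ * ∫ ω in (0 : ℝ)..2 * π, f ω * Complex.exp (Complex.I * ω * n)

theorem norm_exp_neg_I_mul (ω : ℝ) (n : ℤ) : ‖Complex.exp (-(Complex.I * ω * n))‖ = 1 := by
  rw [Complex.norm_exp]
  simp [mul_assoc]

theorem summable_dtft {c : ℤ → ℂ} (hc : Summable c) (ω : ℝ) :
    Summable fun n : ℤ => c n * Complex.exp (-(Complex.I * ω * n)) := by
  refine Summable.of_norm ?_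
  simpa [norm_exp_neg_I_mul] using hc.norm

theorem exp_neg_I_mul_add_two_pi (ω : ℝ) (n : ℤ) :
    Complex.exp (-(Complex.I * (ω + 2 * π : ℝ) * n)) = Complex.exp (-(Complex.I * ω * n)) := by
  rw [Complex.exp_eq_exp_iff_exists_int]
  exact ⟨-n, by push_cast; ring⟩

theorem dtft_periodic (c : ℤ → ℂ) : Function.Periodic (dtft c) (2 * π) := by
  intro ω
  unfold dtft
  simp_rw [exp_neg_I_mul_add_two_pi]

theorem integral_exp_I_mul_int (m : ℤ) :
    ∫ ω in (0 : ℝ)..2 * π, Complex.exp (Complex.I * ω * m) = if m = 0 then 2 * (π : ℂ) else 0 := by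
  split_ifs with h
  · simp [h]
  · have hm : Complex.I * (m : ℂ) ≠ 0 := mul_ne_zero Complex.I_ne_zero (by exact_mod_cast h)
    have h1 := integral_exp_mul_complex (a := 0) (b := 2 * π) hm
    have h2 : ∀ ω : ℝ, Complex.I * ω * m = Complex.I * m * ω := fun ω => by ring
    simp_rw [h2]
    rw [h1]
    have h3 : Complex.exp (Complex.I * m * ((2 * π : ℝ) : ℂ)) = 1 :=
      Complex.exp_eq_one_iff.2 ⟨m, by push_cast; ring⟩
    rw [h3]
    simp

/-- Summability permits termwise integration, and orthogonality of the exponentials leaves one term.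
-/
theorem dtftCoeff_dtft {c : ℤ → ℂ} (hc : Summable c) : dtftCoeff (dtft c) = c := by
  funext n
  have hs : HasSum (fun m : ℤ => ∫ ω in (0 : ℝ)..2 * π,
      c m * Complex.exp (-(Complex.I * ω * m)) * Complex.exp (Complex.I * ω * n))
      (∫ ω in (0 : ℝ)..2 * π, dtft c ω * Complex.exp (Complex.I * ω * n)) := by
    refine intervalIntegral.hasSum_integral_of_dominated_convergence (fun m _ => ‖c m‖) ?_ ?_ ?_ ?_ ?_
    · intro m
      exact Continuous.aestronglyMeasurable (by fun_prop)
    · intro m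
      refine Filter.Eventually.of_forall fun ω _ => ?_
      have := norm_exp_neg_I_mul ω (-n)
      simp only [Int.cast_neg, mul_neg, neg_neg] at this
      rw [norm_mul, norm_mul, norm_exp_neg_I_mul, this]
      simp
    · exact Filter.Eventually.of_forall fun _ _ => hc.norm
    · simp
    · exact Filter.Eventually.of_forall fun ω _ => (summable_dtft hc ω).hasSum.mul_right _
  have ht : ∀ m : ℤ, ∫ ω in (0 : ℝ)..2 * π,
      c m * Complex.exp (-(Complex.I * ω * m)) * Complex.exp (Complex.I * ω * n)
        = if m = n then 2 * (π : ℂ) * c n else 0 := by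
    intro m
    have h1 : ∀ ω : ℝ, c m * Complex.exp (-(Complex.I * ω * m)) * Complex.exp (Complex.I * ω * n)
        = c m * Complex.exp (Complex.I * ω * (n - m : ℤ)) := fun ω => by
      rw [mul_assoc, ← Complex.exp_add]
      congr 2
      push_cast
      ring
    simp_rw [h1]
    rw [intervalIntegral.integral_const_mul, integral_exp_I_mul_int]
    by_cases h : m = n
    · simp [h, mul_comm]
    · rw [if_neg (by omega), if_neg h, mul_zero]
  simp_rw [ht] at hs
  have h2 := hs.unique (hasSum_ite_eq n (2 * (π : ℂ) * c n))
  unfold dtftCoeff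
  rw [h2]
  have : (π : ℂ) ≠ 0 := by exact_mod_cast Real.pi_ne_zero
  field_simp

theorem dtft_injective {c d : ℤ → ℂ} (hc : Summable c) (hd : Summable d)
    (h : ∀ ω, dtft c ω = dtft d ω) : c = d := by
  rw [← dtftCoeff_dtft hc, ← dtftCoeff_dtft hd, funext h]

theorem dtftCoeff_eq_fourierCoeffOn (f : ℝ → ℂ) (n : ℤ) :
    dtftCoeff f n = fourierCoeffOn Real.two_pi_pos f (-n) := by
  rw [fourierCoeffOn_eq_integral, dtftCoeff, Complex.real_smul]
  congr 1
  · push_cast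
    simp
  · refine intervalIntegral.integral_congr fun ω _ => ?_
    simp only [neg_neg, fourier_coe_apply, smul_eq_mul]
    rw [mul_comm]
    congr 2
    have : (π : ℂ) ≠ 0 := by exact_mod_cast Real.pi_ne_zero
    push_cast
    field_simp
    ring

/-- Two integrations by parts, with boundary terms cancelled by periodicity, give decay of order
1/n². -/
theorem summable_dtftCoeff {f : ℝ → ℂ} (hf : ContDiff ℝ 2 f)
    (hp : Function.Periodic f (2 * π)) : Summable (dtftCoeff f) := by
  have hdp : Function.Periodic (deriv f) (2 * π) := fun x => by
    rw [← deriv_comp_add_const]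
    congr 1
    exact funext hp
  have hd : ContDiff ℝ 1 (deriv f) := by
    have : ContDiff ℝ (1 + 1) f := hf
    exact (contDiff_succ_iff_deriv.1 this).2.2
  have key : ∀ g : ℝ → ℂ, ContDiff ℝ 1 g → Function.Periodic g (2 * π) → ∀ n : ℤ, n ≠ 0 →
      ‖dtftCoeff g n‖ ≤ ‖dtftCoeff (deriv g) n‖ / |(n : ℝ)| := by
    intro g hg hgp n hn
    rw [dtftCoeff_eq_fourierCoeffOn, dtftCoeff_eq_fourierCoeffOn,
      fourierCoeffOn_of_hasDerivAt Real.two_pi_pos (neg_ne_zero.2 hn)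
        (fun x _ => (hg.differentiable (by simp) x).hasDerivAt)
        ((hg.continuous_deriv le_rfl).intervalIntegrable _ _)]
    have h0 : g (2 * π) - g 0 = 0 := by
      have := hgp 0
      rw [zero_add] at this
      rw [this, sub_self]
    rw [h0, mul_zero, zero_sub, norm_mul, norm_neg, norm_mul]
    have hpi := Real.pi_pos
    have hn' : (0 : ℝ) < |(n : ℝ)| := abs_pos.2 (by exact_mod_cast hn)
    apply le_of_eq
    simp only [one_div, norm_inv, norm_mul, norm_neg, Int.cast_neg, Complex.norm_I,
      Complex.norm_real, Complex.norm_intCast, mul_neg, ← Complex.ofReal_sub]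
    rw [Real.norm_eq_abs, Real.norm_eq_abs, abs_of_pos hpi, sub_zero, abs_of_pos Real.two_pi_pos]
    simp only [Complex.norm_ofNat]
    field_simp
  have hbound : ∀ g : ℝ → ℂ, Continuous g → ∃ C, ∀ n, ‖dtftCoeff g n‖ ≤ C := by
    intro g hg
    refine ⟨‖(2 * (π : ℂ))⁻¹‖ * ∫ ω in (0 : ℝ)..2 * π, ‖g ω‖, fun n => ?_⟩
    rw [dtftCoeff, norm_mul]
    gcongr
    refine (intervalIntegral.norm_integral_le_integral_norm Real.two_pi_pos.le).trans_eq ?_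
    refine intervalIntegral.integral_congr fun ω _ => ?_
    have := norm_exp_neg_I_mul ω (-n)
    simp only [Int.cast_neg, mul_neg, neg_neg] at this
    simp [this]
  obtain ⟨C, hC⟩ := hbound (deriv (deriv f)) (hd.continuous_deriv le_rfl)
  have hs : Summable fun n : ℤ => C * (1 / |(n : ℝ)| ^ 2) := by
    have := (Real.summable_one_div_int_pow (p := 2)).2 (by norm_num)
    simpa [sq_abs] using this.mul_left C
  refine Summable.of_norm_bounded_eventually hs ?_
  filter_upwards [(Set.finite_singleton (0 : ℤ)).compl_mem_cofinite] with n hn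
  have hn' : n ≠ 0 := hn
  have hpos : (0 : ℝ) < |(n : ℝ)| := abs_pos.2 (by exact_mod_cast hn')
  calc ‖dtftCoeff f n‖ ≤ ‖dtftCoeff (deriv f) n‖ / |(n : ℝ)| :=
        key f (hf.of_le (by norm_num)) hp n hn'
    _ ≤ ‖dtftCoeff (deriv (deriv f)) n‖ / |(n : ℝ)| / |(n : ℝ)| := by
        gcongr
        exact key _ hd hdp n hn'
    _ ≤ C / |(n : ℝ)| / |(n : ℝ)| := by
        gcongr
        exact hC n
    _ = C * (1 / |(n : ℝ)| ^ 2) := by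
        rw [div_div, ← sq]
        ring

/-- On the circle of length 2π this is pointwise convergence of a Fourier series with summable
coefficients; the opposite sign convention in the exponent accounts for the reindexing by n ↦ -n. -/
theorem dtft_dtftCoeff {f : ℝ → ℂ} (hf : ContDiff ℝ 2 f)
    (hp : Function.Periodic f (2 * π)) (ω : ℝ) : dtft (dtftCoeff f) ω = f ω := by
  have : Fact (0 < 2 * π) := ⟨Real.two_pi_pos⟩
  have hcont : Continuous hp.lift := by
    refine continuous_coinduced_dom.2 ?_
    exact hf.continuous
  let F : C(AddCircle (2 * π), ℂ) := ⟨hp.lift, hcont⟩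
  have hF : ∀ x : ℝ, F (x : AddCircle (2 * π)) = f x := fun x => rfl
  have hco : ∀ n, fourierCoeff F n = dtftCoeff f (-n) := by
    intro n
    rw [dtftCoeff_eq_fourierCoeffOn, fourierCoeffOn_eq_integral, fourierCoeff_eq_intervalIntegral _ _ 0]
    simp [hF]
  have hs : Summable (fourierCoeff F) := by
    have : fourierCoeff F = dtftCoeff f ∘ (Equiv.neg ℤ) := funext fun n => by simp [hco]
    rw [this, Equiv.summable_iff]
    exact summable_dtftCoeff hf hp
  have h := has_pointwise_sum_fourier_series_of_summable hs (ω : AddCircle (2 * π))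
  rw [← (Equiv.neg ℤ).hasSum_iff] at h
  rw [← hF ω, ← h.tsum_eq]
  refine tsum_congr fun n => ?_
  simp only [Function.comp_apply, Equiv.neg_apply, hco, neg_neg, fourier_coe_apply, smul_eq_mul]
  congr 2
  have : (π : ℂ) ≠ 0 := by exact_mod_cast Real.pi_ne_zero
  push_cast
  field_simp

/-! ### Convolution on the integers -/

section Conv

variable {E : Type*} [NormedAddCommGroup E] [NormedSpace ℂ E]

/-- Convolution of a scalar kernel with a sequence of vectors. -/
def conv (c : ℤ → ℂ) (y : ℤ → E) (k : ℤ) : E := ∑' n : ℤ, c n • y (k - n)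

theorem summable_norm_conv {c : ℤ → ℂ} (hc : Summable c) {y : ℤ → E} {C : ℝ}
    (hy : ∀ k, ‖y k‖ ≤ C) (k : ℤ) : Summable fun n : ℤ => ‖c n • y (k - n)‖ := by
  refine Summable.of_nonneg_of_le (fun _ => norm_nonneg _) (fun n => ?_) (hc.norm.mul_right C)
  rw [norm_smul]
  gcongr
  exact hy _

theorem norm_conv_le {c : ℤ → ℂ} (hc : Summable c) {y : ℤ → E} {C : ℝ}
    (hy : ∀ k, ‖y k‖ ≤ C) (k : ℤ) : ‖conv c y k‖ ≤ (∑' n, ‖c n‖) * C := by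
  refine (norm_tsum_le_tsum_norm (summable_norm_conv hc hy k)).trans ?_
  rw [← tsum_mul_right]
  refine Summable.tsum_le_tsum (fun n => ?_) (summable_norm_conv hc hy k) (hc.norm.mul_right C)
  rw [norm_smul]
  gcongr
  exact hy _

/-- The shear `(n, m) ↦ (n, n + m)` of `ℤ × ℤ`. -/
def intShear : ℤ × ℤ ≃ ℤ × ℤ where
  toFun p := (p.1, p.1 + p.2)
  invFun p := (p.1, p.2 - p.1)
  left_inv p := by simp
  right_inv p := by simp

theorem summable_conv_prod {c d : ℤ → ℂ} (hc : Summable c) (hd : Summable d) :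
    Summable fun p : ℤ × ℤ => c p.1 * d (p.2 - p.1) := by
  rw [← intShear.summable_iff]
  simpa [intShear, Function.comp_def] using summable_mul_of_summable_norm hc.norm hd.norm

theorem summable_conv {c d : ℤ → ℂ} (hc : Summable c) (hd : Summable d) :
    Summable (conv c d) := by
  have h := ((Equiv.prodComm ℤ ℤ).summable_iff.2 (summable_conv_prod hc hd)).prod
  exact h

theorem exists_norm_le_of_summable {c : ℤ → ℂ} (hc : Summable c) : ∃ C, ∀ k, ‖c k‖ ≤ C :=
  ⟨∑' n, ‖c n‖, fun k => hc.norm.le_tsum k fun _ _ => norm_nonneg _⟩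

variable [CompleteSpace E]

/-- Fubini for an absolutely summable family on ℤ × ℤ; boundedness of `y` suffices for the
domination. -/
theorem conv_conv {c d : ℤ → ℂ} (hc : Summable c) (hd : Summable d) {y : ℤ → E} {C : ℝ}
    (hy : ∀ k, ‖y k‖ ≤ C) (k : ℤ) : conv c (conv d y) k = conv (conv c d) y k := by
  have hs : Summable fun p : ℤ × ℤ => (c p.1 * d (p.2 - p.1)) • y (k - p.2) := by
    refine Summable.of_norm (Summable.of_nonneg_of_le (fun _ => norm_nonneg _) (fun p => ?_)
      ((summable_conv_prod hc hd).norm.mul_right C))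
    rw [norm_smul]
    gcongr
    exact hy _
  have h1 : conv (conv c d) y k
      = ∑' l, ∑' n, (c n * d (l - n)) • y (k - l) := by
    refine tsum_congr fun l => ?_
    obtain ⟨D, hD⟩ := exists_norm_le_of_summable hd
    have h2 : Summable fun n => c n * d (l - n) := (summable_norm_conv hc hD l).of_norm
    simp only [conv, smul_eq_mul]
    exact (h2.tsum_smul_const _).symm
  have h2 := Summable.tsum_comm' (f := fun l n => (c n * d (l - n)) • y (k - l))
    ((Equiv.prodComm ℤ ℤ).summable_iff.2 hs)
    (fun l => ((Equiv.prodComm ℤ ℤ).summable_iff.2 hs).prod_factor l)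
    (fun n => hs.prod_factor n)
  rw [h1, ← h2]
  refine tsum_congr fun n => ?_
  rw [conv, ← (summable_norm_conv hd hy _).of_norm.tsum_const_smul,
    ← (Equiv.subRight n).tsum_eq]
  refine tsum_congr fun l => ?_
  simp only [Equiv.subRight_apply, smul_smul]
  congr 2
  ring

end Conv

/-- The character k ↦ exp(iωk) is an eigenvector of convolution by `c` with eigenvalue `dtft c ω`,
so multiplicativity is associativity of `conv` applied to that character. -/
theorem dtft_conv {c d : ℤ → ℂ} (hc : Summable c) (hd : Summable d) (ω : ℝ) :
    dtft (conv c d) ω = dtft c ω * dtft d ω := by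
  let y : ℤ → ℂ := fun k => Complex.exp (Complex.I * ω * k)
  have hy : ∀ k, ‖y k‖ ≤ 1 := fun k => by
    have := norm_exp_neg_I_mul ω (-k)
    simp only [Int.cast_neg, mul_neg, neg_neg] at this
    exact this.le
  have key : ∀ (a : ℤ → ℂ) (k : ℤ), conv a y k = dtft a ω * y k := by
    intro a k
    rw [dtft, ← tsum_mul_right]
    refine tsum_congr fun n => ?_
    simp only [y, smul_eq_mul, mul_assoc, ← Complex.exp_add]
    congr 2
    push_cast
    ring
  have h := conv_conv hc hd hy 0
  have h2 : conv d y = fun k => dtft d ω * y k := funext (key d)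
  have h3 : conv c (fun k => dtft d ω * y k) 0 = dtft c ω * dtft d ω := by
    have : conv c (fun k => dtft d ω * y k) 0 = dtft d ω * conv c y 0 := by
      simp only [conv]
      rw [← tsum_mul_left]
      refine tsum_congr fun n => ?_
      simp only [smul_eq_mul]
      ring
    rw [this, key]
    simp only [y]
    simp [mul_comm]
  rw [h2, h3, key] at h
  rw [h]
  simp [y]

section ConvLinear

variable {E : Type*} [NormedAddCommGroup E] [NormedSpace ℂ E]

theorem dtft_add {c d : ℤ → ℂ} (hc : Summable c) (hd : Summable d) (ω : ℝ) :
    dtft (fun n => c n + d n) ω = dtft c ω + dtft d ω := by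
  unfold dtft
  rw [← (summable_dtft hc ω).tsum_add (summable_dtft hd ω)]
  simp [add_mul]

theorem dtft_sum {ι : Type*} (s : Finset ι) {c : ι → ℤ → ℂ} (hc : ∀ i, Summable (c i)) (ω : ℝ) :
    dtft (fun n => ∑ i ∈ s, c i n) ω = ∑ i ∈ s, dtft (c i) ω := by
  unfold dtft
  rw [← Summable.tsum_finsetSum fun i _ => summable_dtft (hc i) ω]
  simp [Finset.sum_mul]

theorem summable_delta (a : ℂ) : Summable fun n : ℤ => if n = 0 then a else 0 :=
  (hasSum_ite_eq 0 a).summable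

theorem dtft_delta (a : ℂ) (ω : ℝ) : dtft (fun n : ℤ => if n = 0 then a else 0) ω = a := by
  unfold dtft
  rw [tsum_eq_single 0]
  · simp
  · intro n hn
    simp [hn]

/-- This is the origin of the adjoint factor in the spectral factorisation. -/
theorem dtft_conj_neg (c : ℤ → ℂ) (ω : ℝ) :
    dtft (fun n => conj (c (-n))) ω = conj (dtft c ω) := by
  unfold dtft
  rw [Complex.conj_tsum, ← (Equiv.neg ℤ).tsum_eq]
  refine tsum_congr fun n => ?_
  simp [← Complex.exp_conj]

theorem summable_conj_neg {c : ℤ → ℂ} (hc : Summable c) :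
    Summable fun n : ℤ => conj (c (-n)) := by
  have h := (Equiv.neg ℤ).summable_iff.2 hc
  refine Summable.of_norm ?_
  simpa using h.norm

theorem conv_delta (a : ℂ) (y : ℤ → E) (k : ℤ) :
    conv (fun n : ℤ => if n = 0 then a else 0) y k = a • y k := by
  unfold conv
  rw [tsum_eq_single 0]
  · simp
  · intro n hn
    simp [hn]

variable [CompleteSpace E]

theorem conv_add_left {c d : ℤ → ℂ} (hc : Summable c) (hd : Summable d) {y : ℤ → E} {C : ℝ}
    (hy : ∀ k, ‖y k‖ ≤ C) (k : ℤ) : conv (fun n => c n + d n) y k = conv c y k + conv d y k := by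
  unfold conv
  rw [← (summable_norm_conv hc hy k).of_norm.tsum_add (summable_norm_conv hd hy k).of_norm]
  simp [add_smul]

theorem conv_sum_left {ι : Type*} (s : Finset ι) {c : ι → ℤ → ℂ} (hc : ∀ i, Summable (c i))
    {y : ℤ → E} {C : ℝ} (hy : ∀ k, ‖y k‖ ≤ C) (k : ℤ) :
    conv (fun n => ∑ i ∈ s, c i n) y k = ∑ i ∈ s, conv (c i) y k := by
  unfold conv
  rw [← Summable.tsum_finsetSum fun i _ => (summable_norm_conv (hc i) hy k).of_norm]
  simp [Finset.sum_smul]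

theorem conv_sub {c : ℤ → ℂ} (hc : Summable c) {y z : ℤ → E} {C D : ℝ}
    (hy : ∀ k, ‖y k‖ ≤ C) (hz : ∀ k, ‖z k‖ ≤ D) (k : ℤ) :
    conv c (fun n => y n - z n) k = conv c y k - conv c z k := by
  unfold conv
  rw [← (summable_norm_conv hc hy k).of_norm.tsum_sub (summable_norm_conv hc hz k).of_norm]
  simp [smul_sub]

theorem conv_sum {ι : Type*} (s : Finset ι) {c : ℤ → ℂ} (hc : Summable c)
    {y : ι → ℤ → E} {C : ι → ℝ} (hy : ∀ i k, ‖y i k‖ ≤ C i) (k : ℤ) :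
    conv c (fun n => ∑ i ∈ s, y i n) k = ∑ i ∈ s, conv c (y i) k := by
  unfold conv
  rw [← Summable.tsum_finsetSum fun i _ => (summable_norm_conv hc (hy i) k).of_norm]
  simp [Finset.smul_sum]

end ConvLinear

section MatrixKernel

variable {U : Type*}

/-- The transfer matrix of a matrix of scalar kernels. -/
def dtftMatrix (K : U → U → ℤ → ℂ) (ω : ℝ) : Matrix U U ℂ := fun u w => dtft (K u w) ω

variable [Fintype U]

/-- Every bounded solution of `X = K ⋆ X + E` is `G ⋆ E` if the transfer matrix of `G` inverts
that of `1 - K`. -/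
theorem eq_sum_conv_of_inverse [DecidableEq U] {E : Type*} [NormedAddCommGroup E] [NormedSpace ℂ E]
    [CompleteSpace E] {K G : U → U → ℤ → ℂ} (hK : ∀ u w, Summable (K u w))
    (hG : ∀ u w, Summable (G u w))
    (hinv : ∀ ω, dtftMatrix G ω * (1 - dtftMatrix K ω) = 1) {x y : U → ℤ → E} {C : ℝ}
    (hx : ∀ u k, ‖x u k‖ ≤ C) (hxy : ∀ u k, x u k = ∑ w, conv (K u w) (x w) k + y u k)
    (u : U) (k : ℤ) : x u k = ∑ w, conv (G u w) (y w) k := by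
  -- By injectivity of the transform, the frequency-domain inverse relation becomes G = δ + G ⋆ K.
  -- Then G ⋆ (x - K ⋆ x) telescopes to x.
  have hseq : ∀ u v, G u v = fun n => (if n = 0 then (1 : Matrix U U ℂ) u v else 0)
      + ∑ w, conv (G u w) (K w v) n := by
    intro u v
    have hs : Summable fun n : ℤ => ∑ w, conv (G u w) (K w v) n :=
      summable_sum fun w _ => summable_conv (hG u w) (hK w v)
    refine dtft_injective (hG u v) ((summable_delta _).add hs) fun ω => ?_
    rw [dtft_add (summable_delta _) hs, dtft_delta,
      dtft_sum _ fun w => summable_conv (hG u w) (hK w v)]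
    have h := congrFun (congrFun (hinv ω) u) v
    rw [mul_sub, mul_one, Matrix.sub_apply, Matrix.mul_apply] at h
    rw [← h]
    simp_rw [dtft_conv (hG u _) (hK _ v)]
    simp [dtftMatrix]
  have hxs : ∀ w v k, ‖conv (K w v) (x v) k‖ ≤ (∑' n, ‖K w v n‖) * C := fun w v =>
    norm_conv_le (hK w v) (hx v)
  have hy : ∀ w, y w = fun k => x w k - ∑ v, conv (K w v) (x v) k := fun w => by
    funext k
    rw [hxy w k]
    simp
  have hsum : ∀ w k, ‖∑ v, conv (K w v) (x v) k‖ ≤ ∑ v, (∑' n, ‖K w v n‖) * C := fun w k =>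
    (norm_sum_le _ _).trans (Finset.sum_le_sum fun v _ => hxs w v k)
  have h1 : ∀ w, conv (G u w) (y w) k
      = conv (G u w) (x w) k - ∑ v, conv (conv (G u w) (K w v)) (x v) k := fun w => by
    rw [hy w, conv_sub (hG u w) (hx w) (hsum w), conv_sum _ (hG u w) (hxs w)]
    simp_rw [conv_conv (hG u w) (hK w _) (hx _)]
  have h2 : ∀ v, conv (G u v) (x v) k
      = (1 : Matrix U U ℂ) u v • x v k + ∑ w, conv (conv (G u w) (K w v)) (x v) k := fun v => by
    conv_lhs => rw [hseq u v]
    rw [conv_add_left (summable_delta _)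
      (summable_sum fun w _ => summable_conv (hG u w) (hK w v)) (hx v), conv_delta,
      conv_sum_left _ (fun w => summable_conv (hG u w) (hK w v)) (hx v)]
  simp_rw [h1, h2, Finset.sum_sub_distrib, Finset.sum_add_distrib]
  rw [Finset.sum_comm (f := fun v w => conv (conv (G u w) (K w v)) (x v) k), add_sub_cancel_right]
  simp [Matrix.one_apply]

open scoped InnerProductSpace in
/-- The correlations of `G ⋆ Y`, where `Y` is stationary with correlations `R`. -/
theorem inner_eq_conv_of_stationary {E : Type*} [NormedAddCommGroup E] [InnerProductSpace ℂ E]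
    [CompleteSpace E] {G R : U → U → ℤ → ℂ} (hG : ∀ u w, Summable (G u w)) {x y : U → ℤ → E}
    {C : ℝ} (hy : ∀ u k, ‖y u k‖ ≤ C) (hR : ∀ u w k l, ⟪y w l, y u k⟫_ℂ = R u w (k - l))
    (hx : ∀ u k, x u k = ∑ w, conv (G u w) (y w) k) (u v : U) (k : ℤ) :
    ⟪x v 0, x u k⟫_ℂ
      = ∑ w', conv (fun n => conj (G v w' (-n))) (fun l => ∑ w, conv (G u w) (R w w') l) k := by
  have key : ∀ h u k, ⟪h, x u k⟫_ℂ = ∑ w, ∑' n, G u w n * ⟪h, y w (k - n)⟫_ℂ := by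
    intro h u k
    rw [hx, inner_sum]
    refine Finset.sum_congr rfl fun w _ => ?_
    have hs := (summable_norm_conv (hG u w) (hy w) k).of_norm
    have := (innerSL ℂ h).map_tsum hs
    simp only [innerSL_apply_apply, inner_smul_right] at this
    exact this
  have h1 : ∀ w' l u k, ⟪y w' l, x u k⟫_ℂ = ∑ w, conv (G u w) (R w w') (k - l) := by
    intro w' l u k
    rw [key]
    refine Finset.sum_congr rfl fun w _ => tsum_congr fun n => ?_
    rw [hR, smul_eq_mul]
    congr 2
    ring
  rw [← inner_conj_symm, key, map_sum]
  refine Finset.sum_congr rfl fun w' _ => ?_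
  rw [Complex.conj_tsum, conv, ← (Equiv.neg ℤ).tsum_eq]
  refine tsum_congr fun m => ?_
  rw [map_mul, inner_conj_symm, h1]
  simp

open scoped InnerProductSpace in
/-- The spectral density of `G ⋆ Y`, where `Y` is stationary with correlations `R`. -/
theorem dtftMatrix_inner_of_stationary {E : Type*} [NormedAddCommGroup E] [InnerProductSpace ℂ E]
    [CompleteSpace E] {G R : U → U → ℤ → ℂ} (hG : ∀ u w, Summable (G u w))
    (hRs : ∀ u w, Summable (R u w)) {x y : U → ℤ → E}
    {C : ℝ} (hy : ∀ u k, ‖y u k‖ ≤ C) (hR : ∀ u w k l, ⟪y w l, y u k⟫_ℂ = R u w (k - l))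
    (hx : ∀ u k, x u k = ∑ w, conv (G u w) (y w) k) :
    (∀ u v, Summable fun k => ⟪x v 0, x u k⟫_ℂ) ∧
    ∀ ω, dtftMatrix (fun u v k => ⟪x v 0, x u k⟫_ℂ) ω
      = dtftMatrix G ω * dtftMatrix R ω * (dtftMatrix G ω).conjTranspose := by
  have h := inner_eq_conv_of_stationary hG hy hR hx
  have hs1 : ∀ u w', Summable fun l : ℤ => ∑ w, conv (G u w) (R w w') l := fun u w' =>
    summable_sum fun w _ => summable_conv (hG u w) (hRs w w')
  have hs2 : ∀ u v w', Summable
      (conv (fun n => conj (G v w' (-n))) (fun l => ∑ w, conv (G u w) (R w w') l)) :=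
    fun u v w' => summable_conv (summable_conj_neg (hG v w')) (hs1 u w')
  refine ⟨fun u v => ?_, fun ω => ?_⟩
  · simp_rw [h]
    exact summable_sum fun w' _ => hs2 u v w'
  · ext u v
    simp only [dtftMatrix, h, Matrix.mul_apply, Matrix.conjTranspose_apply]
    rw [dtft_sum _ (hs2 u v)]
    refine Finset.sum_congr rfl fun w' _ => ?_
    rw [dtft_conv (summable_conj_neg (hG v w')) (hs1 u w'), dtft_conj_neg,
      dtft_sum _ fun w => summable_conv (hG u w) (hRs w w'), mul_comm]
    simp_rw [dtft_conv (hG u _) (hRs _ w')]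
    rfl

end MatrixKernel

/-- A series that converges absolutely in `Lᵖ` has the same sum as its pointwise series. -/
theorem Lp_tsum_eq_of_ae_hasSum {Ω : Type*} [MeasurableSpace Ω] {P : Measure Ω}
    {f : ℤ → Lp ℂ 2 P} {g : Lp ℂ 2 P} (hf : Summable f)
    (hfg : ∀ᵐ s ∂P, HasSum (fun n => f n s) (g s)) : ∑' n, f n = g := by
  -- Symmetric intervals turn the unconditional sum into a sequence, from which L² convergence
  -- extracts an almost everywhere convergent subsequence.
  have hT : Filter.Tendsto (fun N : ℕ => Finset.Icc (-(N : ℤ)) N) Filter.atTop Filter.atTop := by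
    refine Filter.tendsto_atTop_finset_of_monotone ?_ ?_
    · intro a b hab
      exact Finset.Icc_subset_Icc (by simpa using hab) (by simpa using hab)
    · intro n
      exact ⟨n.natAbs, by simp only [Finset.mem_Icc]; omega⟩
  have h1 := hf.hasSum.comp hT
  obtain ⟨ns, hns, h2⟩ := (tendstoInMeasure_of_tendsto_Lp h1).exists_seq_tendsto_ae
  have h3 : ∀ᵐ s ∂P, ∀ N : ℕ, (∑ n ∈ Finset.Icc (-(N : ℤ)) N, f n : Lp ℂ 2 P) s
      = ∑ n ∈ Finset.Icc (-(N : ℤ)) N, f n s := by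
    rw [ae_all_iff]
    intro N
    filter_upwards [Lp.coeFn_finsetSum (E := ℂ) (p := 2) (μ := P) (Finset.Icc (-(N : ℤ)) N) f]
      with s hs
    rw [hs, Finset.sum_apply]
  refine Lp.ext ?_
  filter_upwards [h2, h3, hfg] with s h2s h3s hs
  refine tendsto_nhds_unique h2s ?_
  simp only [Function.comp_apply, h3s]
  exact hs.comp (hT.comp hns.tendsto_atTop)

/-! ### Lifting of scalar filters -/

section Lifting

/-- The index map `(m, t) ↦ m T + p - t` of the lifting. -/
def liftEquiv (T : ℕ) [NeZero T] (p : ℤ) : ℤ × Fin T ≃ ℤ :=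
  (((Equiv.neg ℤ).prodCongr (Equiv.refl (Fin T))).trans (Int.divModEquiv T).symm).trans
    (Equiv.subLeft p)

theorem liftEquiv_apply (T : ℕ) [NeZero T] (p m : ℤ) (t : Fin T) :
    liftEquiv T p (m, t) = m * T + p - (t : ℕ) := by
  simp [liftEquiv, Int.divModEquiv]
  ring

variable {T : ℕ}

/-- The kernel of the filter `c` acting on lifted signals. -/
def liftKernel (T : ℕ) (c : ℤ → ℂ) (p t : Fin T) (m : ℤ) : ℂ := c (m * T + (p : ℕ) - (t : ℕ))

/-- The transfer matrix of the filter `c` acting on lifted signals. -/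
def liftMatrix (T : ℕ) (c : ℤ → ℂ) (ω : ℝ) : Matrix (Fin T) (Fin T) ℂ :=
  dtftMatrix (liftKernel T c) ω

theorem summable_liftKernel {c : ℤ → ℂ} (hc : Summable c) (p t : Fin T) :
    Summable (liftKernel T c p t) := by
  have hT : (T : ℤ) ≠ 0 := by
    have := p.pos
    omega
  refine hc.comp_injective (i := fun m : ℤ => m * T + (p : ℕ) - (t : ℕ)) fun a b hab => ?_
  have : a * (T : ℤ) = b * T := by
    simp only at hab
    linarith
  exact mul_right_cancel₀ hT this

/-- The frequencies `θ` with `T θ = ω` modulo `2 π`. -/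
def aliasFreq (T : ℕ) (ω : ℝ) (r : Fin T) : ℝ := (ω + 2 * π * (r : ℕ)) / T

/-- The eigenvectors of lifted filters. -/
def aliasMatrix (T : ℕ) (ω : ℝ) : Matrix (Fin T) (Fin T) ℂ :=
  fun p r => Complex.exp (Complex.I * aliasFreq T ω r * (p : ℕ))

/-- A sampled exponential of frequency θ with Tθ ≡ ω is an eigenvector: n = mT + p - t runs over ℤ
once as (m, t) varies, so the lifted sum reassembles into `dtft c θ`. -/
theorem liftMatrix_mul_aliasMatrix {c : ℤ → ℂ} (hc : Summable c) (ω : ℝ) :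
    liftMatrix T c ω * aliasMatrix T ω
      = aliasMatrix T ω * Matrix.diagonal fun r => dtft c (aliasFreq T ω r) := by
  ext p r
  have : NeZero T := ⟨by have := p.pos; omega⟩
  have hT : (T : ℂ) ≠ 0 := by exact_mod_cast NeZero.ne T
  rw [Matrix.mul_apply, Matrix.mul_diagonal]
  have h1 : ∀ t : Fin T, liftMatrix T c ω p t * aliasMatrix T ω t r
      = ∑' m : ℤ, aliasMatrix T ω p r * (c (liftEquiv T (p : ℕ) (m, t)) *
        Complex.exp (-(Complex.I * aliasFreq T ω r * (liftEquiv T (p : ℕ) (m, t) : ℤ)))) := by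
    intro t
    rw [liftMatrix, dtftMatrix, dtft, ← tsum_mul_right]
    refine tsum_congr fun m => ?_
    simp only [liftEquiv_apply, liftKernel, aliasMatrix]
    rw [mul_left_comm, ← Complex.exp_add, mul_assoc, ← Complex.exp_add]
    congr 1
    rw [Complex.exp_eq_exp_iff_exists_int]
    -- Since T times the r-th alias frequency is ω + 2πr, the exponents differ by 2πi · rm.
    refine ⟨(r : ℕ) * m, ?_⟩
    unfold aliasFreq
    push_cast
    field_simp
    ring
  simp_rw [h1]
  have hs : Summable fun x : ℤ × Fin T => aliasMatrix T ω p r * (c (liftEquiv T (p : ℕ) x) *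
        Complex.exp (-(Complex.I * aliasFreq T ω r * (liftEquiv T (p : ℕ) x : ℤ)))) :=
    (((liftEquiv T (p : ℕ)).summable_iff.2 (summable_dtft hc (aliasFreq T ω r)))).mul_left _
  have hs' := (Equiv.prodComm (Fin T) ℤ).summable_iff.2 hs
  have h2 := hs'.tsum_prod
  rw [tsum_fintype (L := .unconditional (Fin T))] at h2
  simp only [Function.comp_apply, Equiv.prodComm_apply, Prod.swap_prod_mk] at h2
  rw [← h2]
  have h3 := (Equiv.prodComm (Fin T) ℤ).tsum_eq fun x : ℤ × Fin T =>
    aliasMatrix T ω p r * (c (liftEquiv T (p : ℕ) x) *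
        Complex.exp (-(Complex.I * aliasFreq T ω r * (liftEquiv T (p : ℕ) x : ℤ))))
  simp only [Equiv.prodComm_apply] at h3
  rw [h3, tsum_mul_left, dtft]
  congr 1
  exact (liftEquiv T (p : ℕ)).tsum_eq
    fun n => c n * Complex.exp (-(Complex.I * aliasFreq T ω r * (n : ℤ)))

/-- Distinct rows are orthogonal because their inner product is a full geometric sum of a T-th root
of unity other than 1; 0 < |p - t| < T excludes the value 1. -/
theorem aliasMatrix_mul_conjTranspose (ω : ℝ) :
    aliasMatrix T ω * (aliasMatrix T ω).conjTranspose = (T : ℂ) • (1 : Matrix (Fin T) (Fin T) ℂ) := by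
  ext p t
  have hT : (T : ℂ) ≠ 0 := by
    have := p.pos
    exact_mod_cast (by omega : T ≠ 0)
  set w : ℂ := Complex.exp (2 * π * Complex.I * ((p : ℕ) - (t : ℕ)) / T) with hw
  have h1 : ∀ r : Fin T, aliasMatrix T ω p r * star (aliasMatrix T ω t r)
      = Complex.exp (Complex.I * ω * ((p : ℕ) - (t : ℕ)) / T) * w ^ (r : ℕ) := by
    intro r
    simp only [aliasMatrix, RCLike.star_def, ← Complex.exp_conj, hw]
    rw [← Complex.exp_nat_mul, ← Complex.exp_add, ← Complex.exp_add]
    congr 1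
    have h2 : (starRingEnd ℂ) 2 = 2 := Complex.conj_ofNat 2
    simp [aliasFreq, h2]
    field_simp
    ring
  rw [Matrix.mul_apply]
  simp only [Matrix.conjTranspose_apply, h1, Matrix.smul_apply, smul_eq_mul]
  rw [← Finset.mul_sum, Fin.sum_univ_eq_sum_range (fun r => w ^ r) T]
  by_cases h : p = t
  · subst h
    have : w = 1 := by simp [hw]
    simp [this]
  · rw [Matrix.one_apply_ne h, mul_zero]
    have hw1 : w ≠ 1 := by
      intro h1
      rw [hw, Complex.exp_eq_one_iff] at h1
      obtain ⟨n, hn⟩ := h1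
      have h2 : (((p : ℕ) : ℂ) - ((t : ℕ) : ℂ)) = n * T := by
        have hpi : (2 * (π : ℂ) * Complex.I) ≠ 0 := Complex.two_pi_I_ne_zero
        field_simp at hn
        linear_combination hn
      have h3 : ((p : ℕ) : ℤ) - ((t : ℕ) : ℤ) = n * T := by exact_mod_cast h2
      have hp := p.2
      have ht := t.2
      have hne : (p : ℕ) ≠ t := fun h' => h (Fin.ext h')
      have hn1 : |n| * (T : ℤ) < T := by
        have : |((p : ℕ) : ℤ) - ((t : ℕ) : ℤ)| = |n| * T := by
          rw [h3, abs_mul, abs_of_nonneg (by positivity : (0 : ℤ) ≤ (T : ℤ))]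
        rw [← this, abs_lt]
        constructor <;> omega
      have hn0 : n = 0 := by
        by_contra hn0
        have : 1 ≤ |n| := Int.one_le_abs hn0
        nlinarith
      rw [hn0] at h3
      omega
    have hwT : w ^ T = 1 := by
      rw [hw, ← Complex.exp_nat_mul, Complex.exp_eq_one_iff]
      exact ⟨(p : ℕ) - (t : ℕ), by push_cast; field_simp⟩
    rw [geom_sum_eq hw1, hwT, sub_self, zero_div, mul_zero]

/-- Diagonalisation written entrywise: a finite sum, through which smoothness of `dtft c` passes to
the lifted matrix. -/
theorem liftMatrix_apply {c : ℤ → ℂ} (hc : Summable c) (ω : ℝ) (p t : Fin T) :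
    liftMatrix T c ω p t = (T : ℂ)⁻¹ * ∑ r, aliasMatrix T ω p r * dtft c (aliasFreq T ω r)
      * conj (aliasMatrix T ω t r) := by
  have hT : (T : ℂ) ≠ 0 := by
    have := p.pos
    exact_mod_cast (by omega : T ≠ 0)
  have h := congrArg (fun A => A * (aliasMatrix T ω).conjTranspose)
    (liftMatrix_mul_aliasMatrix hc ω)
  simp only [Matrix.mul_assoc] at h
  rw [aliasMatrix_mul_conjTranspose] at h
  have h2 := congrFun (congrFun h p) t
  rw [← Matrix.mul_assoc] at h2
  simp only [Matrix.mul_smul, Matrix.mul_one, Matrix.smul_apply, smul_eq_mul] at h2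
  rw [eq_inv_mul_iff_mul_eq₀ hT, h2, Matrix.mul_apply]
  simp [Matrix.mul_diagonal]

theorem det_aliasMatrix_ne_zero (ω : ℝ) : (aliasMatrix T ω).det ≠ 0 := by
  intro h
  have h1 := congrArg Matrix.det (aliasMatrix_mul_conjTranspose (T := T) ω)
  rw [Matrix.det_mul, h, zero_mul, Matrix.det_smul, Matrix.det_one, mul_one, Fintype.card_fin] at h1
  rcases Nat.eq_zero_or_pos T with rfl | hT
  · simp at h1
  · exact pow_ne_zero _ (by exact_mod_cast hT.ne') h1.symm

theorem det_liftMatrix {c : ℤ → ℂ} (hc : Summable c) (ω : ℝ) :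
    (liftMatrix T c ω).det = ∏ r, dtft c (aliasFreq T ω r) := by
  have h := congrArg Matrix.det (liftMatrix_mul_aliasMatrix (T := T) hc ω)
  rw [Matrix.det_mul, Matrix.det_mul, Matrix.det_diagonal, mul_comm] at h
  exact mul_left_cancel₀ (det_aliasMatrix_ne_zero ω) h

theorem contDiff_liftMatrix {c : ℤ → ℂ} (hc : Summable c) {n : WithTop ℕ∞}
    (h : ContDiff ℝ n (dtft c)) (p t : Fin T) :
    ContDiff ℝ n fun ω => liftMatrix T c ω p t := by
  simp_rw [liftMatrix_apply hc]
  have hfreq : ∀ r, ContDiff ℝ n fun ω => aliasFreq T ω r := fun r => by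
    unfold aliasFreq
    fun_prop
  have halias : ∀ p r, ContDiff ℝ n fun ω => aliasMatrix T ω p r := fun p r => by
    unfold aliasMatrix
    have h1 : ContDiff ℝ n fun ω => ((aliasFreq T ω r : ℝ) : ℂ) :=
      Complex.ofRealCLM.contDiff.comp (hfreq r)
    exact ((contDiff_const.mul h1).mul contDiff_const).cexp
  refine contDiff_const.mul (ContDiff.sum fun r _ => ?_)
  refine ((halias p r).mul (h.comp (hfreq r))).mul ?_
  exact (Complex.conjCLE.contDiff).comp (halias t r)

theorem liftMatrix_periodic (T : ℕ) (c : ℤ → ℂ) : Function.Periodic (liftMatrix T c) (2 * π) := by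
  intro ω
  ext p t
  exact dtft_periodic _ ω

end Lifting

/-! ### Smooth inverses of matrix functions -/

theorem contDiff_det {U : Type*} [Fintype U] [DecidableEq U] {n : WithTop ℕ∞}
    {A : ℝ → Matrix U U ℂ} (hA : ∀ u w, ContDiff ℝ n fun ω => A ω u w) :
    ContDiff ℝ n fun ω => (A ω).det := by
  simp_rw [Matrix.det_apply]
  refine ContDiff.sum fun σ _ => ContDiff.const_smul _ (contDiff_prod fun i _ => hA _ _)

/-- Cramer's rule: each entry is a quotient of determinants of smooth matrices. -/
theorem contDiff_inv {U : Type*} [Fintype U] [DecidableEq U] {n : WithTop ℕ∞}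
    {A : ℝ → Matrix U U ℂ} (hA : ∀ u w, ContDiff ℝ n fun ω => A ω u w)
    (hu : ∀ ω, IsUnit (A ω)) (u w : U) : ContDiff ℝ n fun ω => (A ω)⁻¹ u w := by
  simp only [Matrix.inv_def, Ring.inverse_eq_inv', Matrix.smul_apply, smul_eq_mul,
    Matrix.adjugate_apply]
  refine ((contDiff_det hA).inv fun ω => ?_).mul (contDiff_det fun a b => ?_)
  · exact ((Matrix.isUnit_iff_isUnit_det _).1 (hu ω)).ne_zero
  · by_cases h : a = w
    · subst h
      simp only [Matrix.updateRow_self]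
      exact contDiff_const
    · simp only [Matrix.updateRow_ne h]
      exact hA a b

/-! ### Frequency responses of the node filters and the summable inverse of I - ℍ -/

namespace LDM

variable {V : Type*} (M : LDM V)

theorem differentiable_den (i : V) : Differentiable ℂ (M.den i) := by
  unfold den
  fun_prop

/-- The transfer function `1 / S_i` in the delay variable `q = z⁻¹`. -/
def delayFilter (i : V) (q : ℂ) : ℂ := (1 + q) ^ (M.a i).natDegree / M.den i q

/-- Stability keeps the denominator nonzero on the closed disc, so only the numerator (1 + q)^d can
vanish, and only if d > 0. -/
theorem delayFilter_eq_zero_iff {M : LDM V} (hs : M.IsStable) (i : V) {q : ℂ} (hq : ‖q‖ ≤ 1) :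
    M.delayFilter i q = 0 ↔ q = -1 ∧ 1 ≤ (M.a i).natDegree := by
  rw [delayFilter, div_eq_zero_iff, or_iff_left (hs i q hq), pow_eq_zero_iff', add_comm,
    add_eq_zero_iff_eq_neg, Nat.one_le_iff_ne_zero]

theorem differentiableAt_delayFilter {M : LDM V} (hs : M.IsStable) (i : V) {q : ℂ}
    (hq : ‖q‖ ≤ 1) : DifferentiableAt ℂ (M.delayFilter i) q := by
  unfold delayFilter
  exact DifferentiableAt.div (by fun_prop) (M.differentiable_den i q) (hs i q hq)

/-- The frequency response of `1 / S_i`. -/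
def response (i : V) (θ : ℝ) : ℂ := M.delayFilter i (Complex.exp (-(Complex.I * θ)))

theorem norm_exp_neg_I (θ : ℝ) : ‖Complex.exp (-(Complex.I * θ))‖ = 1 := by
  simpa using norm_exp_neg_I_mul θ 1

theorem contDiff_response {M : LDM V} (hs : M.IsStable) (i : V) : ContDiff ℝ 2 (M.response i) := by
  have hq : ContDiff ℝ 2 fun θ : ℝ => Complex.exp (-(Complex.I * θ)) :=
    ((contDiff_const.mul Complex.ofRealCLM.contDiff).neg).cexp
  have hden : ContDiff ℝ 2 fun θ : ℝ => M.den i (Complex.exp (-(Complex.I * θ))) := by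
    unfold den
    refine ContDiff.sum fun n _ => ?_
    exact (contDiff_const.mul ((contDiff_const.sub hq).pow _)).mul ((contDiff_const.add hq).pow _)
  simp only [funext fun θ => response.eq_def M i θ, delayFilter, div_eq_mul_inv]
  exact ((contDiff_const.add hq).pow _).mul (hden.inv fun θ => hs i _ (norm_exp_neg_I θ).le)

theorem response_periodic (i : V) : Function.Periodic (M.response i) (2 * π) := by
  intro θ
  have := exp_neg_I_mul_add_two_pi θ 1
  simp only [Int.cast_one, mul_one] at this
  rw [response, this, response]

/-- The impulse response of `1 / S_i`. -/
def filterCoeff (i : V) : ℤ → ℂ := dtftCoeff (M.response i)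

theorem summable_filterCoeff {M : LDM V} (hs : M.IsStable) (i : V) : Summable (M.filterCoeff i) :=
  summable_dtftCoeff (contDiff_response hs i) (M.response_periodic i)

theorem dtft_filterCoeff {M : LDM V} (hs : M.IsStable) (i : V) :
    dtft (M.filterCoeff i) = M.response i :=
  funext (dtft_dtftCoeff (contDiff_response hs i) (M.response_periodic i))

/-- The lifted transfer matrix of `1 / S_i`. -/
def liftedFilter (T : ℕ) (i : V) : ℝ → Matrix (Fin T) (Fin T) ℂ := liftMatrix T (M.filterCoeff i)

theorem det_liftedFilter {M : LDM V} (hs : M.IsStable) (T : ℕ) (i : V) (ω : ℝ) :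
    (M.liftedFilter T i ω).det = ∏ r, M.response i (aliasFreq T ω r) := by
  rw [liftedFilter, det_liftMatrix (summable_filterCoeff hs i), dtft_filterCoeff hs]

variable [DecidableEq V]

/-- Substituting z = exp(iθ) turns the contour integral into an inverse Fourier transform; the
factor iz of dz cancels the i in 1/(2πi) and raises z^(n-1) to z^n. -/
theorem impulse_eq (i j : V) (n : ℤ) :
    M.impulse i j n = if i = j then 0 else M.b i j * M.filterCoeff i n := by
  have h1 : ∀ θ : ℝ, deriv (circleMap 0 1) θ • (circleMap 0 1 θ ^ (n - 1) * M.h i j (circleMap 0 1 θ))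
      = (if i = j then 0 else Complex.I * M.b i j) *
        (M.response i θ * Complex.exp (Complex.I * θ * n)) := by
    intro θ
    have hz : circleMap 0 1 θ ≠ 0 := circleMap_ne_center one_ne_zero
    have hz' : circleMap 0 1 θ = Complex.exp (Complex.I * θ) := by
      simp [circleMap, mul_comm]
    have hzn : circleMap 0 1 θ ^ n = Complex.exp (Complex.I * θ * n) := by
      rw [hz', ← Complex.exp_int_mul, mul_comm]
    rw [deriv_circleMap, smul_eq_mul, ← hzn, zpow_sub_one₀ hz]
    unfold h invS response delayFilter
    rw [Complex.exp_neg, ← hz']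
    split_ifs
    · simp
    · field_simp
  unfold impulse circleIntegral
  simp_rw [h1]
  rw [intervalIntegral.integral_const_mul]
  split_ifs
  · simp
  · unfold filterCoeff dtftCoeff
    rw [mul_inv]
    linear_combination ((2 * (π : ℂ))⁻¹ * M.b i j * ∫ ω in (0 : ℝ)..2 * π,
      M.response i ω * Complex.exp (Complex.I * ω * n)) * inv_mul_cancel₀ Complex.I_ne_zero

theorem summable_impulse {M : LDM V} (hs : M.IsStable) (i j : V) : Summable (M.impulse i j) := by
  simp_rw [funext (M.impulse_eq i j)]
  split_ifs
  · exact summable_zero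
  · exact (summable_filterCoeff hs i).mul_left _

theorem liftedTransfer_eq (T : ℕ) (ω : ℝ) (i j : V) (p t : Fin T) :
    M.liftedTransfer T ω (i, p) (j, t)
      = if i = j then 0 else M.b i j * M.liftedFilter T i ω p t := by
  unfold liftedTransfer
  simp only [impulse_eq]
  split_ifs
  · simp
  · rw [liftedFilter, liftMatrix, dtftMatrix, dtft, ← tsum_mul_left]
    refine tsum_congr fun n => ?_
    rw [liftKernel]
    ring

theorem contDiff_liftedTransfer {M : LDM V} (hs : M.IsStable) (T : ℕ) (u w : V × Fin T) :
    ContDiff ℝ 2 fun ω => M.liftedTransfer T ω u w := by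
  obtain ⟨i, p⟩ := u
  obtain ⟨j, t⟩ := w
  simp_rw [liftedTransfer_eq]
  split_ifs
  · exact contDiff_const
  · refine contDiff_const.mul (contDiff_liftMatrix (summable_filterCoeff hs i) ?_ p t)
    rw [dtft_filterCoeff hs]
    exact contDiff_response hs i

theorem liftedTransfer_periodic (T : ℕ) : Function.Periodic (M.liftedTransfer T) (2 * π) := by
  intro ω
  ext ⟨i, p⟩ ⟨j, t⟩
  simp_rw [liftedTransfer_eq, liftedFilter, liftMatrix_periodic T _ ω]

/-- Absolutely summable impulse response of `(I - ℍ)⁻¹`. -/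
theorem exists_kernel_inverse [Fintype V] {M : LDM V} (hs : M.IsStable) {T : ℕ}
    (hw : M.WellPosed T) : ∃ G : V × Fin T → V × Fin T → ℤ → ℂ, (∀ u w, Summable (G u w)) ∧
      ∀ ω, dtftMatrix G ω = (1 - M.liftedTransfer T ω)⁻¹ := by
  have hc : ∀ u w, ContDiff ℝ 2 fun ω => (1 - M.liftedTransfer T ω)⁻¹ u w := fun u w =>
    contDiff_inv (A := fun ω => 1 - M.liftedTransfer T ω)
      (fun a b => contDiff_const.sub (contDiff_liftedTransfer hs T a b)) hw u w
  have hp : ∀ u w, Function.Periodic (fun ω => (1 - M.liftedTransfer T ω)⁻¹ u w) (2 * π) :=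
    fun u w ω => by simp only [liftedTransfer_periodic M T ω]
  refine ⟨fun u w => dtftCoeff fun ω => (1 - M.liftedTransfer T ω)⁻¹ u w,
    fun u w => summable_dtftCoeff (hc u w) (hp u w), fun ω => ?_⟩
  ext u w
  exact dtft_dtftCoeff (hc u w) (hp u w) ω

end LDM

/-! ### The lifted dynamics in L² and the output spectrum -/

theorem conv_eq_sum_conv_liftKernel {E : Type*} [NormedAddCommGroup E] [NormedSpace ℂ E]
    [CompleteSpace E] {T : ℕ} {c : ℤ → ℂ} (hc : Summable c) {y : ℤ → E} {C : ℝ}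
    (hy : ∀ k, ‖y k‖ ≤ C) (k : ℤ) (p : Fin T) :
    conv c y (k * T + (p : ℕ))
      = ∑ t, conv (liftKernel T c p t) (fun m => y (m * T + (t : ℕ))) k := by
  have : NeZero T := ⟨by have := p.pos; omega⟩
  have hs := (summable_norm_conv hc hy (k * T + (p : ℕ))).of_norm
  let e := (Equiv.prodComm (Fin T) ℤ).trans (liftEquiv T (p : ℕ))
  have h1 := (e.summable_iff.2 hs).tsum_prod
  rw [tsum_fintype (L := .unconditional (Fin T))] at h1
  have h2 := e.tsum_eq fun n => c n • y (k * T + (p : ℕ) - n)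
  simp only [Function.comp_apply] at h1
  rw [conv, ← h2, h1]
  refine Finset.sum_congr rfl fun t _ => tsum_congr fun m => ?_
  have h3 : e (t, m) = m * T + (p : ℕ) - (t : ℕ) := liftEquiv_apply T _ m t
  rw [h3, liftKernel]
  congr 2
  ring

section Lp

variable {Ω : Type*} [MeasurableSpace Ω] {P : Measure Ω}

theorem inner_toLp {f g : Ω → ℂ} (hf : MemLp f 2 P) (hg : MemLp g 2 P) :
    inner ℂ (hf.toLp f) (hg.toLp g) = ∫ s, g s * conj (f s) ∂P := by
  rw [L2.inner_def]
  refine integral_congr_ae ?_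
  filter_upwards [hf.coeFn_toLp, hg.coeFn_toLp] with s h1 h2
  rw [h1, h2, RCLike.inner_apply]

theorem norm_toLp_sq {f : Ω → ℂ} (hf : MemLp f 2 P) :
    ‖hf.toLp f‖ ^ 2 = ∫ s, ‖f s‖ ^ 2 ∂P := by
  have h1 : ((‖hf.toLp f‖ ^ 2 : ℝ) : ℂ) = inner ℂ (hf.toLp f) (hf.toLp f) := by
    rw [inner_self_eq_norm_sq_to_K]
    push_cast
    rfl
  rw [inner_toLp] at h1
  have h2 : ∀ s, f s * conj (f s) = ((‖f s‖ ^ 2 : ℝ) : ℂ) := fun s => by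
    rw [Complex.mul_conj, Complex.normSq_eq_norm_sq]
  simp_rw [h2] at h1
  rw [integral_complex_ofReal] at h1
  exact_mod_cast h1

end Lp

section Stationarity

variable {V Ω : Type*} [MeasurableSpace Ω] {P : Measure Ω}

theorem HasPeriod.integral_shift {y : ℤ → Ω → ℂ} {T : ℕ} (h : HasPeriod P y T) (s t m : ℤ) :
    ∫ ξ, y (s + m * T) ξ * conj (y (t + m * T) ξ) ∂P = ∫ ξ, y s ξ * conj (y t ξ) ∂P := by
  have hp : Function.Periodic
      (fun m : ℤ => ∫ ξ, y (s + m * T) ξ * conj (y (t + m * T) ξ) ∂P) 1 := by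
    intro m
    have := h.2 (s + m * T) (t + m * T)
    simp only
    rw [← this]
    congr 3
    ring_nf
  have := hp.int_mul_eq m
  simpa using this

/-- Shifting the lifted index by l shifts time by lT, a multiple of each period, so the lifted input
is stationary; between distinct nodes both sides vanish. -/
theorem integral_lifted_eq_autocorr {τ : V → ℕ} {T : ℕ} (hT : ∀ i, τ i ∣ T) {e : V → ℤ → Ω → ℂ}
    (he : IsExogenousInput P τ e) (u w : V × Fin T) (k l : ℤ) :
    ∫ ξ, lifted T e k u ξ * conj (lifted T e l w ξ) ∂P = autocorr P T e (k - l) u w := by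
  unfold autocorr lifted
  by_cases h : u.1 = w.1
  · rw [← h]
    obtain ⟨m, hm⟩ := hT u.1
    have := (he.wscs u.1).period.integral_shift ((k - l) * T + (u.2 : ℕ)) (0 * T + (w.2 : ℕ)) (l * m)
    rw [← this]
    have hm' : (T : ℤ) = τ u.1 * m := by exact_mod_cast hm
    have h1 : (k - l) * T + (u.2 : ℕ) + l * m * τ u.1 = k * T + (u.2 : ℕ) := by
      linear_combination (-l) * hm'
    have h2 : 0 * (T : ℤ) + (w.2 : ℕ) + l * m * τ u.1 = l * T + (w.2 : ℕ) := by
      linear_combination (-l) * hm'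
    rw [h1, h2]
  · rw [he.uncorrelated _ _ h, he.uncorrelated _ _ h]

end Stationarity

namespace LDM

variable {V : Type*} [DecidableEq V] [Fintype V] {Ω : Type*} [MeasurableSpace Ω] {P : Measure Ω}
  {M : LDM V} {e x : V → ℤ → Ω → ℂ}

/-- The dynamics of the output, as an identity in `L²`. -/
theorem IsOutput.toLp_eq (hs : M.IsStable) (hx : M.IsOutput P e x) (he : ∀ i k, MemLp (e i k) 2 P)
    {C : ℝ} (hC : ∀ i k, ‖(hx.memLp i k).toLp‖ ≤ C) (i : V) (κ : ℤ) :
    (hx.memLp i κ).toLp = ∑ j, conv (M.impulse i j) (fun k => (hx.memLp j k).toLp) κ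
      + (he i κ).toLp := by
  have hsum : ∀ j, Summable fun n => M.impulse i j n • (hx.memLp j (κ - n)).toLp := fun j =>
    (summable_norm_conv (summable_impulse hs i j) (y := fun k => (hx.memLp j k).toLp) (hC j) κ).of_norm
  have h := Lp_tsum_eq_of_ae_hasSum (P := P)
    (f := fun n => ∑ j, M.impulse i j n • (hx.memLp j (κ - n)).toLp)
    (g := (hx.memLp i κ).toLp - (he i κ).toLp) (summable_sum fun j _ => hsum j) ?_
  · rw [Summable.tsum_finsetSum fun j _ => hsum j] at h
    exact eq_add_of_sub_eq h.symm
  · have h1 : ∀ᵐ s ∂P, ∀ n : ℤ, (∑ j, M.impulse i j n • (hx.memLp j (κ - n)).toLp : Lp ℂ 2 P) s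
        = ∑ j, M.impulse i j n * x j (κ - n) s := by
      rw [ae_all_iff]
      intro n
      have h2 : ∀ᵐ s ∂P, ∀ j, (M.impulse i j n • (hx.memLp j (κ - n)).toLp : Lp ℂ 2 P) s
          = M.impulse i j n * x j (κ - n) s := by
        rw [ae_all_iff]
        intro j
        filter_upwards [Lp.coeFn_smul (M.impulse i j n) ((hx.memLp j (κ - n)).toLp),
          (hx.memLp j (κ - n)).coeFn_toLp] with s h3 h4
        rw [h3, Pi.smul_apply, h4, smul_eq_mul]
      filter_upwards [h2, Lp.coeFn_finsetSum (E := ℂ) (p := 2) (μ := P) Finset.univ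
        fun j => M.impulse i j n • (hx.memLp j (κ - n)).toLp] with s h3 h4
      rw [h4, Finset.sum_apply]
      exact Finset.sum_congr rfl fun j _ => h3 j
    filter_upwards [h1, hx.dynamics i κ, Lp.coeFn_sub (hx.memLp i κ).toLp (he i κ).toLp,
      (hx.memLp i κ).coeFn_toLp, (he i κ).coeFn_toLp] with s h2 h3 h4 h5 h6
    rw [h4, Pi.sub_apply, h5, h6]
    simp_rw [h2]
    exact h3

/-- The power spectral density of the output. -/
theorem IsOutput.psd_eq (hs : M.IsStable) {τ : V → ℕ} {T : ℕ} (hT : ∀ i, τ i ∣ T)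
    (he : IsExogenousInput P τ e) (hpsd : HasPSD P T e) (hw : M.WellPosed T)
    (hx : M.IsOutput P e x) :
    HasPSD P T x ∧ ∀ ω, psd P T x ω = (1 - M.liftedTransfer T ω)⁻¹ * psd P T e ω *
      ((1 - M.liftedTransfer T ω)⁻¹).conjTranspose := by
  have hem : ∀ i k, MemLp (e i k) 2 P := fun i k => (he.wscs i).memLp k
  obtain ⟨C, hC⟩ := hx.bounded
  have hC' : ∀ i k, ‖(hx.memLp i k).toLp‖ ≤ √C := fun i k => by
    refine Real.le_sqrt_of_sq_le ?_
    rw [norm_toLp_sq]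
    exact hC i k
  have hdyn := hx.toLp_eq hs hem hC'
  obtain ⟨G, hG, hGinv⟩ := exists_kernel_inverse hs hw
  let X : V × Fin T → ℤ → Lp ℂ 2 P := fun u k => (hx.memLp u.1 (k * T + (u.2 : ℕ))).toLp
  let E : V × Fin T → ℤ → Lp ℂ 2 P := fun u k => (hem u.1 (k * T + (u.2 : ℕ))).toLp
  let K : V × Fin T → V × Fin T → ℤ → ℂ := fun u w => liftKernel T (M.impulse u.1 w.1) u.2 w.2
  have hK : ∀ u w, Summable (K u w) := fun u w =>
    summable_liftKernel (summable_impulse hs u.1 w.1) _ _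
  have hinv : ∀ ω, dtftMatrix G ω * (1 - dtftMatrix K ω) = 1 := fun ω => by
    rw [hGinv]
    exact Matrix.nonsing_inv_mul _ ((Matrix.isUnit_iff_isUnit_det _).1 (hw ω))
  have hXE : ∀ u k, X u k = ∑ w, conv (K u w) (X w) k + E u k := by
    intro u k
    have h := hdyn u.1 (k * T + (u.2 : ℕ))
    simp only [X, E]
    rw [h, Fintype.sum_prod_type]
    congr 1
    refine Finset.sum_congr rfl fun j _ => ?_
    exact conv_eq_sum_conv_liftKernel (summable_impulse hs u.1 j)
      (y := fun k => (hx.memLp j k).toLp) (hC' j) k u.2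
  have hXb : ∀ u k, ‖X u k‖ ≤ √C := fun u k => hC' _ _
  have hXG := eq_sum_conv_of_inverse hK hG hinv hXb hXE
  -- Boundedness of the inputs is read off from E = X - K ⋆ X.
  have hEb : ∀ u k, ‖E u k‖ ≤ √C + ∑ w, (∑' n, ‖K u w n‖) * √C := by
    intro u k
    have h1 : E u k = X u k - ∑ w, conv (K u w) (X w) k := by
      rw [hXE u k]
      simp
    rw [h1]
    refine (norm_sub_le _ _).trans (add_le_add (hXb u k) ?_)
    exact (norm_sum_le _ _).trans (Finset.sum_le_sum fun w _ => norm_conv_le (hK u w) (hXb w) k)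
  have hEb' : ∀ u k, ‖E u k‖ ≤ ∑ u, (√C + ∑ w, (∑' n, ‖K u w n‖) * √C) := fun u k =>
    (hEb u k).trans (Finset.single_le_sum
      (f := fun u => √C + ∑ w, (∑' n, ‖K u w n‖) * √C) (fun u _ => by positivity)
      (Finset.mem_univ u))
  have hR : ∀ u w k l, inner ℂ (E w l) (E u k) = autocorr P T e (k - l) u w := by
    intro u w k l
    rw [inner_toLp]
    exact integral_lifted_eq_autocorr hT he u w k l
  have hRX : (fun u v k => inner ℂ (X v 0) (X u k)) = fun u v k => autocorr P T x k u v := by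
    funext u v k
    rw [inner_toLp]
    rfl
  obtain ⟨h1, h2⟩ := dtftMatrix_inner_of_stationary (R := fun u w n => autocorr P T e n u w)
    hG hpsd hEb' hR hXG
  refine ⟨fun u v => ?_, fun ω => ?_⟩
  · have := h1 u v
    rwa [congrFun (congrFun hRX u) v] at this
  · have := h2 ω
    rw [hRX, hGinv] at this
    exact this

end LDM

/-! ### Block matrices and the block diagonal input spectrum -/

section Blocks

variable {V : Type*} {T : ℕ}

theorem block_mul [Fintype V] (A B : Matrix (V × Fin T) (V × Fin T) ℂ) (j i : V) :
    block (A * B) j i = ∑ k, block A j k * block B k i := by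
  ext p r
  simp [block, Matrix.mul_apply, Fintype.sum_prod_type, Matrix.sum_apply]

theorem block_conjTranspose (A : Matrix (V × Fin T) (V × Fin T) ℂ) (j i : V) :
    block A.conjTranspose j i = (block A i j).conjTranspose := rfl

theorem block_one [DecidableEq V] (j i : V) :
    block (1 : Matrix (V × Fin T) (V × Fin T) ℂ) j i = if j = i then 1 else 0 := by
  ext p r
  by_cases h : j = i
  · simp [block, h, Matrix.one_apply]
  · simp [block, h]

theorem block_ext {A B : Matrix (V × Fin T) (V × Fin T) ℂ}
    (h : ∀ j i, block A j i = block B j i) : A = B := by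
  ext ⟨j, p⟩ ⟨i, r⟩
  exact congrFun (congrFun (h j i) p) r

/-- The block diagonal matrix with given diagonal blocks. -/
def ofBlocks [DecidableEq V] (D : V → Matrix (Fin T) (Fin T) ℂ) :
    Matrix (V × Fin T) (V × Fin T) ℂ := fun u w => if u.1 = w.1 then D u.1 u.2 w.2 else 0

theorem block_ofBlocks [DecidableEq V] (D : V → Matrix (Fin T) (Fin T) ℂ) (j i : V) :
    block (ofBlocks D) j i = if j = i then D j else 0 := by
  ext p r
  by_cases h : j = i <;> simp [block, ofBlocks, h]

theorem ofBlocks_mul [Fintype V] [DecidableEq V] (D F : V → Matrix (Fin T) (Fin T) ℂ) :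
    ofBlocks D * ofBlocks F = ofBlocks fun i => D i * F i := by
  refine block_ext fun j i => ?_
  rw [block_mul]
  simp only [block_ofBlocks]
  by_cases h : j = i
  · subst h
    rw [Finset.sum_eq_single j] <;> simp +contextual [eq_comm]
  · rw [if_neg h]
    refine Finset.sum_eq_zero fun k _ => ?_
    by_cases hk : j = k
    · have hki : k ≠ i := fun h' => h (hk.trans h')
      rw [if_neg hki, mul_zero]
    · rw [if_neg hk, zero_mul]

end Blocks

section Input

variable {V Ω : Type*} [MeasurableSpace Ω] {P : Measure Ω} {τ : V → ℕ} {T : ℕ}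
  {e : V → ℤ → Ω → ℂ}

theorem psd_periodic (T : ℕ) (e : V → ℤ → Ω → ℂ) : Function.Periodic (psd P T e) (2 * π) := by
  intro ω
  ext u w
  exact dtft_periodic _ ω

theorem TopologicallyDetectable.posDef (h : TopologicallyDetectable P T e) (i : V) (ω : ℝ) :
    (block (psd P T e ω) i i).PosDef := by
  obtain ⟨y, hy, hy'⟩ := (psd_periodic (P := P) T e).exists_mem_Ico₀ Real.two_pi_pos ω
  rw [hy']
  exact h i y hy

theorem psd_eq_ofBlocks [DecidableEq V] (he : IsExogenousInput P τ e) (ω : ℝ) :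
    psd P T e ω = ofBlocks fun i => block (psd P T e ω) i i := by
  refine block_ext fun j i => ?_
  rw [block_ofBlocks]
  by_cases h : j = i
  · simp [h]
  · rw [if_neg h]
    ext p r
    simp [block, psd, autocorr, lifted, he.uncorrelated _ _ h]

theorem psd_inv_eq [Fintype V] [DecidableEq V] (he : IsExogenousInput P τ e)
    (hdet : TopologicallyDetectable P T e) (ω : ℝ) :
    IsUnit (psd P T e ω) ∧ (psd P T e ω)⁻¹ = ofBlocks fun i => (block (psd P T e ω) i i)⁻¹ := by
  have h : (ofBlocks fun i => (block (psd P T e ω) i i)⁻¹) * psd P T e ω = 1 := by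
    conv_lhs => rw [psd_eq_ofBlocks he]
    rw [ofBlocks_mul]
    refine block_ext fun j i => ?_
    rw [block_ofBlocks, block_one]
    congr 1
    rw [← psd_eq_ofBlocks he, Matrix.nonsing_inv_mul _
      ((Matrix.isUnit_iff_isUnit_det _).1 (hdet.posDef j ω).isUnit)]
  exact ⟨IsUnit.of_mul_eq_one_right _ h, Matrix.inv_eq_left_inv h⟩

end Input

theorem aliasFreq_mul {T : ℕ} (ω : ℝ) (r : Fin T) :
    (T : ℝ) * aliasFreq T ω r = ω + 2 * π * (r : ℕ) := by
  have hT : (T : ℝ) ≠ 0 := by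
    have := r.pos
    exact_mod_cast (by omega : T ≠ 0)
  unfold aliasFreq
  field_simp

/-- The map ω ↦ exp(-iω) is injective on a half-open period. -/
theorem finite_exp_eq (a : ℂ) :
    {ω ∈ Ico (0 : ℝ) (2 * π) | Complex.exp (-(Complex.I * ω)) = a}.Finite := by
  refine Set.Subsingleton.finite ?_
  rintro x ⟨hx, hxa⟩ y ⟨hy, hya⟩
  rw [← hya, Complex.exp_eq_exp_iff_exists_int] at hxa
  obtain ⟨n, hn⟩ := hxa
  have h1 : (x : ℂ) = y - n * (2 * π) := by
    have := Complex.I_ne_zero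
    have h2 : Complex.I * (x : ℂ) = Complex.I * (y - n * (2 * π)) := by linear_combination -hn
    exact mul_left_cancel₀ this h2
  have h2 : x = y - n * (2 * π) := by exact_mod_cast h1
  have hpi := Real.pi_pos
  have h3 : n = 0 := by
    have ha : (n : ℝ) < 1 := by
      by_contra hc
      push Not at hc
      nlinarith [hx.1, hx.2, hy.1, hy.2]
    have hb : (-1 : ℝ) < n := by
      by_contra hc
      push Not at hc
      nlinarith [hx.1, hx.2, hy.1, hy.2]
    have ha' : n < 1 := by exact_mod_cast ha
    have hb' : -1 < n := by exact_mod_cast hb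
    omega
  simpa [h3] using h2

theorem Matrix.PosSemidef.nonneg_of_mem_spectrum {n : Type*} [Fintype n] [DecidableEq n]
    {A : Matrix n n ℂ} (hA : A.PosSemidef) {μ : ℂ} (hμ : μ ∈ spectrum ℂ A) : μ = ‖μ‖ := by
  rw [hA.isHermitian.spectrum_eq_image_range] at hμ
  obtain ⟨_, ⟨k, rfl⟩, rfl⟩ := hμ
  simp [abs_of_nonneg (hA.eigenvalues_nonneg k)]

open scoped Pointwise in
theorem mem_spectrum_exp_smul {n : Type*} [Fintype n] [DecidableEq n]
    {A : Matrix n n ℂ} (hA : A.PosSemidef) {c : ℝ} {μ : ℂ}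
    (hμ : μ ∈ spectrum ℂ (Complex.exp (c * Complex.I) • A)) :
    μ = ‖μ‖ * Complex.exp (c * Complex.I) := by
  let z : ℂˣ := Units.mk0 (Complex.exp (c * Complex.I)) (Complex.exp_ne_zero _)
  have h : spectrum ℂ (Complex.exp (c * Complex.I) • A) = z • spectrum ℂ A :=
    spectrum.unit_smul_eq_smul A z
  rw [h] at hμ
  obtain ⟨l, hl, hlμ⟩ := hμ
  have h1 := hA.nonneg_of_mem_spectrum hl
  have h2 : μ = Complex.exp (c * Complex.I) * l := hlμ.symm
  rw [h2, norm_mul, Complex.norm_exp_ofReal_mul_I, one_mul, ← h1, mul_comm]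

/-! ### Blocks of the inverse output spectrum and strict spouses -/

namespace LDM

variable {V : Type*} {M : LDM V}

/-- The determinant vanishes only if exp(-iθ) = -1 at some alias frequency θ; taking T-th powers
gives exp(-iω) = (-1)^T. -/
theorem finite_det_liftedFilter_eq_zero (hs : M.IsStable) (T : ℕ) (i : V) :
    {ω ∈ Ico (0 : ℝ) (2 * π) | (M.liftedFilter T i ω).det = 0}.Finite := by
  refine (finite_exp_eq ((-1) ^ T)).subset ?_
  rintro ω ⟨hω, h⟩
  refine ⟨hω, ?_⟩
  rw [det_liftedFilter hs, Finset.prod_eq_zero_iff] at h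
  obtain ⟨r, -, hr⟩ := h
  rw [response, delayFilter_eq_zero_iff hs i (norm_exp_neg_I _).le] at hr
  rw [← hr.1, ← Complex.exp_nat_mul, Complex.exp_eq_exp_iff_exists_int]
  have h2 : (T : ℂ) * aliasFreq T ω r = ω + 2 * π * (r : ℕ) := by
    exact_mod_cast aliasFreq_mul ω r
  exact ⟨(r : ℕ), by push_cast; linear_combination Complex.I * h2⟩

variable [DecidableEq V]

theorem edge_iff (hs : M.IsStable) (i j : V) : M.Edge i j ↔ i ≠ j ∧ M.b i j ≠ 0 := by
  unfold Edge
  constructor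
  · intro h
    have : ∃ z, M.h i j z ≠ 0 := by
      by_contra hc
      push Not at hc
      exact h (funext hc)
    obtain ⟨z, hz⟩ := this
    unfold LDM.h at hz
    split_ifs at hz with hij
    · exact absurd rfl hz
    · exact ⟨hij, left_ne_zero_of_mul hz⟩
  · rintro ⟨hij, hb⟩ h
    -- The point z = 1 is a witness: the numerator of 1/S_i is 2^d there.
    have h1 := congrFun h 1
    simp only [LDM.h, if_neg hij, Pi.zero_apply, mul_eq_zero, hb, false_or] at h1
    have h2 : M.delayFilter i 1 = 0 := by simpa [invS, delayFilter] using h1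
    rw [delayFilter_eq_zero_iff hs i (by simp)] at h2
    norm_num at h2

theorem block_one_sub_liftedTransfer (M : LDM V) (T : ℕ) (ω : ℝ) (k i : V) :
    block (1 - M.liftedTransfer T ω) k i
      = if k = i then 1 else -(M.b k i • M.liftedFilter T k ω) := by
  have h1 : block (1 - M.liftedTransfer T ω) k i
      = block 1 k i - block (M.liftedTransfer T ω) k i := rfl
  have h2 : block (M.liftedTransfer T ω) k i
      = if k = i then 0 else M.b k i • M.liftedFilter T k ω := by
    ext p r
    simp only [block, liftedTransfer_eq]
    split_ifs <;> simp
  rw [h1, h2, block_one]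
  split_ifs <;> simp

theorem exists_phase (hs : M.IsStable) (hphase : M.SameOutgoingPhase) {i k₀ : V}
    (hk₀ : k₀ ∈ M.children i) {k : V} (hk : k ≠ i) :
    M.b k i = ‖M.b k i‖ * Complex.exp ((M.b k₀ i).arg * Complex.I) := by
  by_cases hb : M.b k i = 0
  · simp [hb]
  · rw [hphase i k₀ hk₀ k ((edge_iff hs k i).2 ⟨hk, hb⟩), Complex.norm_mul_exp_arg_mul_I]

variable [Fintype V] {Ω : Type*} [MeasurableSpace Ω] {P : Measure Ω} {τ : V → ℕ} {T : ℕ}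
  {e x : V → ℤ → Ω → ℂ}

theorem IsOutput.isUnit_psd (hs : M.IsStable) (hT : ∀ i, τ i ∣ T) (he : IsExogenousInput P τ e)
    (hpsd : HasPSD P T e) (hdet : TopologicallyDetectable P T e) (hw : M.WellPosed T)
    (hx : M.IsOutput P e x) (ω : ℝ) : IsUnit (psd P T x ω) := by
  rw [(hx.psd_eq hs hT he hpsd hw).2 ω]
  have h1 : IsUnit (1 - M.liftedTransfer T ω)⁻¹ := (Matrix.isUnit_nonsing_inv_iff).2 (hw ω)
  exact (h1.mul (psd_inv_eq he hdet ω).1).mul h1.star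

/-- Inverting the factorisation eliminates (I - ℍ)⁻¹, so the blocks depend explicitly on the
weights. -/
theorem IsOutput.psd_inv (hs : M.IsStable) (hT : ∀ i, τ i ∣ T) (he : IsExogenousInput P τ e)
    (hpsd : HasPSD P T e) (hdet : TopologicallyDetectable P T e) (hw : M.WellPosed T)
    (hx : M.IsOutput P e x) (ω : ℝ) :
    (psd P T x ω)⁻¹ = (1 - M.liftedTransfer T ω).conjTranspose *
      (ofBlocks fun i => (block (psd P T e ω) i i)⁻¹) * (1 - M.liftedTransfer T ω) := by
  have hdet1 := (Matrix.isUnit_iff_isUnit_det _).1 (hw ω)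
  rw [(hx.psd_eq hs hT he hpsd hw).2 ω, Matrix.mul_inv_rev, Matrix.mul_inv_rev,
    Matrix.conjTranspose_nonsing_inv, Matrix.nonsing_inv_nonsing_inv _ hdet1,
    Matrix.nonsing_inv_nonsing_inv _ ?_, (psd_inv_eq he hdet ω).2, Matrix.mul_assoc]
  rw [Matrix.det_conjTranspose]
  exact hdet1.star

/-- Off-diagonal blocks of the inverse spectral density of the output. -/
theorem IsOutput.block_psd_inv (hs : M.IsStable) (hT : ∀ i, τ i ∣ T)
    (he : IsExogenousInput P τ e) (hpsd : HasPSD P T e) (hdet : TopologicallyDetectable P T e)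
    (hw : M.WellPosed T) (hx : M.IsOutput P e x) {i j : V} (hij : i ≠ j) (ω : ℝ) :
    block (psd P T x ω)⁻¹ j i
      = -(conj (M.b i j) • ((M.liftedFilter T i ω).conjTranspose * (block (psd P T e ω) i i)⁻¹))
        - M.b j i • ((block (psd P T e ω) j j)⁻¹ * M.liftedFilter T j ω)
        + ∑ k ∈ (Finset.univ.erase i).erase j, (conj (M.b k j) * M.b k i) •
          ((M.liftedFilter T k ω).conjTranspose * (block (psd P T e ω) k k)⁻¹ *
            M.liftedFilter T k ω) := by
  have h1 : block (psd P T x ω)⁻¹ j i = ∑ k, (block (1 - M.liftedTransfer T ω) k j).conjTranspose *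
      (block (psd P T e ω) k k)⁻¹ * block (1 - M.liftedTransfer T ω) k i := by
    rw [hx.psd_inv hs hT he hpsd hdet hw, block_mul]
    refine Finset.sum_congr rfl fun k _ => ?_
    rw [block_mul, Finset.sum_eq_single k]
    · rw [block_ofBlocks, if_pos rfl, block_conjTranspose]
    · intro l _ hl
      rw [block_ofBlocks, if_neg hl, mul_zero]
    · simp
  rw [h1, ← Finset.add_sum_erase _ _ (Finset.mem_univ i),
    ← Finset.add_sum_erase _ _ (Finset.mem_erase.2 ⟨hij.symm, Finset.mem_univ j⟩), ← add_assoc]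
  simp only [block_one_sub_liftedTransfer]
  congr 1
  · simp [hij, hij.symm, sub_eq_add_neg]
  · refine Finset.sum_congr rfl fun k hk => ?_
    simp only [Finset.mem_erase, Finset.mem_univ, and_true] at hk
    rw [if_neg hk.1, if_neg hk.2]
    simp [smul_smul, mul_comm]

/-- The block of strict spouses is a phase times a positive semidefinite matrix that is definite
outside finitely many frequencies. -/
theorem StrictSpouses.block_eq (hs : M.IsStable) (hphase : M.SameOutgoingPhase)
    (hT : ∀ i, τ i ∣ T)
    (he : IsExogenousInput P τ e) (hpsd : HasPSD P T e) (hdet : TopologicallyDetectable P T e)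
    (hw : M.WellPosed T) (hx : M.IsOutput P e x) {i j : V} (h : M.StrictSpouses i j) :
    ∃ (c : ℝ) (k : V), ∀ ω, ∃ Q : Matrix (Fin T) (Fin T) ℂ,
      block (psd P T x ω)⁻¹ j i = Complex.exp (c * Complex.I) • Q ∧ Q.PosSemidef ∧
        ((M.liftedFilter T k ω).det ≠ 0 → Q.PosDef) := by
  obtain ⟨hij, ⟨k₀, hk₀, hjk₀⟩, hadj⟩ := h
  have hk₀j : k₀ ∈ M.children j := hjk₀
  have hki := (edge_iff hs k₀ i).1 hk₀
  have hkj := (edge_iff hs k₀ j).1 hjk₀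
  have hbij : M.b i j = 0 := by
    by_contra hb
    exact hadj (Or.inl ((edge_iff hs i j).2 ⟨hij, hb⟩))
  have hbji : M.b j i = 0 := by
    by_contra hb
    exact hadj (Or.inr ((edge_iff hs j i).2 ⟨hij.symm, hb⟩))
  have hmem : k₀ ∈ (Finset.univ.erase i).erase j := by simp [hki.1, hkj.1]
  -- Any child of `i` has the same outgoing phase, and likewise for `j`, so this is the phase of
  -- every nonzero conj(b_kj) b_ki.
  refine ⟨(M.b k₀ i).arg - (M.b k₀ j).arg, k₀, fun ω => ?_⟩
  let N : V → Matrix (Fin T) (Fin T) ℂ := fun k => (M.liftedFilter T k ω).conjTranspose *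
    (block (psd P T e ω) k k)⁻¹ * M.liftedFilter T k ω
  let ρ : V → ℂ := fun k => ((‖M.b k j‖ * ‖M.b k i‖ : ℝ) : ℂ)
  have hρ : ∀ k, 0 ≤ ρ k := fun k => by
    simp only [ρ]
    exact_mod_cast mul_nonneg (norm_nonneg _) (norm_nonneg _)
  have hN : ∀ k, (ρ k • N k).PosSemidef := fun k =>
    ((hdet.posDef k ω).inv.posSemidef.conjTranspose_mul_mul_same _).smul (hρ k)
  refine ⟨∑ k ∈ (Finset.univ.erase i).erase j, ρ k • N k, ?_,
    Matrix.posSemidef_sum _ fun k _ => hN k, fun hne => ?_⟩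
  · rw [hx.block_psd_inv hs hT he hpsd hdet hw hij, hbij, hbji, Finset.smul_sum]
    simp only [map_zero, zero_smul, neg_zero, sub_zero, zero_add]
    refine Finset.sum_congr rfl fun k hk => ?_
    simp only [Finset.mem_erase, Finset.mem_univ, and_true] at hk
    rw [smul_smul]
    congr 1
    conv_lhs => rw [exists_phase hs hphase hk₀ hk.2, exists_phase hs hphase hk₀j hk.1]
    rw [map_mul, ← Complex.exp_conj, Complex.conj_ofReal, map_mul, Complex.conj_ofReal,
      Complex.conj_I]
    simp only [ρ]
    have : Complex.exp (((M.b k₀ i).arg - (M.b k₀ j).arg : ℝ) * Complex.I)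
        = Complex.exp ((M.b k₀ j).arg * -Complex.I) * Complex.exp ((M.b k₀ i).arg * Complex.I) := by
      rw [← Complex.exp_add]
      congr 1
      push_cast
      ring
    rw [this]
    push_cast
    ring
  · rw [← Finset.add_sum_erase _ _ hmem]
    refine Matrix.PosDef.add_posSemidef ?_ (Matrix.posSemidef_sum _ fun k _ => hN k)
    refine Matrix.PosDef.smul ((hdet.posDef k₀ ω).inv.conjTranspose_mul_mul_same ?_) ?_
    · rw [Matrix.mulVec_injective_iff_isUnit, Matrix.isUnit_iff_isUnit_det]
      exact hne.isUnit
    · simp only [ρ]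
      exact_mod_cast mul_pos (norm_pos_iff.2 hkj.2) (norm_pos_iff.2 hki.2)

theorem StrictSpouses.hasConstantPhase (hs : M.IsStable) (hphase : M.SameOutgoingPhase)
    (hT0 : 0 < T) (hT : ∀ i, τ i ∣ T)
    (he : IsExogenousInput P τ e) (hpsd : HasPSD P T e) (hdet : TopologicallyDetectable P T e)
    (hw : M.WellPosed T) (hx : M.IsOutput P e x) {i j : V} (h : M.StrictSpouses i j) :
    (∃ c : ℝ, HasConstantPhase (fun ω => block (psd P T x ω)⁻¹ j i) c) ∧
      {ω ∈ Ico (0 : ℝ) (2 * π) | 0 ∈ spectrum ℂ (block (psd P T x ω)⁻¹ j i)}.Finite := by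
  obtain ⟨c, k, hQ⟩ := h.block_eq hs hphase hT he hpsd hdet hw hx
  have hfin := finite_det_liftedFilter_eq_zero hs T k
  have hne : ∀ ω, (M.liftedFilter T k ω).det ≠ 0 →
      0 ∉ spectrum ℂ (block (psd P T x ω)⁻¹ j i) := by
    intro ω hω
    obtain ⟨Q, h1, -, h2⟩ := hQ ω
    rw [h1, spectrum.zero_mem_iff, not_not]
    exact (h2 hω).isUnit.smul (Units.mk0 _ (Complex.exp_ne_zero (c * Complex.I)))
  refine ⟨⟨c, fun ω _ μ hμ => ?_, ?_⟩, hfin.subset fun ω hω => ⟨hω.1, ?_⟩⟩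
  · obtain ⟨Q, h1, h2, -⟩ := hQ ω
    simp only [h1] at hμ
    exact mem_spectrum_exp_smul h2 hμ
  · obtain ⟨ω, hω, hω'⟩ := ((Set.Ico_infinite Real.two_pi_pos).sdiff hfin).nonempty
    have : Nonempty (Fin T) := ⟨⟨0, hT0⟩⟩
    obtain ⟨μ, hμ⟩ := spectrum.nonempty_of_isAlgClosed_of_finiteDimensional ℂ
      (block (psd P T x ω)⁻¹ j i)
    refine ⟨ω, hω, μ, hμ, ?_⟩
    rintro rfl
    exact hne ω (fun h0 => hω' ⟨hω, h0⟩) hμ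
  · by_contra h0
    exact hne ω h0 hω.2

end LDM

/-! ### Generic failure of constant phase -/

/-- The determinant is the product of the characteristic roots with multiplicity, each contributing
one factor `z`. -/
theorem det_eq_norm_mul_of_phase {n : Type*} [Fintype n] [DecidableEq n] {A : Matrix n n ℂ} {z : ℂ}
    (h : ∀ μ ∈ spectrum ℂ A, μ = ‖μ‖ * z) : A.det = ‖A.det‖ * z ^ Fintype.card n := by
  have key : ∀ s : Multiset ℂ, (∀ μ ∈ s, μ = ‖μ‖ * z) →
      s.prod = ‖s.prod‖ * z ^ Multiset.card s := by
    intro s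
    induction s using Multiset.induction_on with
    | empty => simp
    | cons a s ih =>
      intro hs
      have h1 := hs a (Multiset.mem_cons_self a s)
      have h2 := ih fun μ hμ => hs μ (Multiset.mem_cons_of_mem hμ)
      rw [Multiset.prod_cons, Multiset.card_cons, norm_mul]
      conv_lhs => rw [h1, h2]
      push_cast
      ring
  have h1 := key A.charpoly.roots fun μ hμ =>
    h μ (Matrix.mem_spectrum_iff_isRoot_charpoly.2 (Polynomial.isRoot_of_mem_roots hμ))
  rwa [← Matrix.det_eq_prod_roots_charpoly, IsAlgClosed.card_roots_eq_natDegree,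
    Matrix.charpoly_natDegree_eq_dim] at h1

/-- The common phase factor cancels against its conjugate. This replaces a spectral condition by one
polynomial in the weights' magnitudes. -/
theorem HasConstantPhase.im_det_mul_conj_eq_zero {T : ℕ} {A : ℝ → Matrix (Fin T) (Fin T) ℂ}
    {c : ℝ} (h : HasConstantPhase A c) {ω₁ ω₂ : ℝ} (h₁ : ω₁ ∈ Ico (0 : ℝ) (2 * π))
    (h₂ : ω₂ ∈ Ico (0 : ℝ) (2 * π)) : ((A ω₁).det * conj (A ω₂).det).im = 0 := by
  rw [det_eq_norm_mul_of_phase (h.1 ω₁ h₁), det_eq_norm_mul_of_phase (h.1 ω₂ h₂), map_mul,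
    Complex.conj_ofReal, mul_mul_mul_comm, Complex.mul_conj, ← Complex.ofReal_mul,
    ← Complex.ofReal_mul, Complex.ofReal_im]

/-- A holomorphic function that is real on the unit circle is constant there. -/
theorem eq_center_of_im_eq_zero_on_circle {F : ℂ → ℂ}
    (hF : ∀ z, ‖z‖ ≤ 1 → DifferentiableAt ℂ F z) (him : ∀ z, ‖z‖ = 1 → (F z).im = 0) {z : ℂ}
    (hz : ‖z‖ = 1) : F z = F 0 := by
  -- The mean value property, used for F, making F(0) real, and for (F - F(0))², making a
  -- nonnegative continuous function integrate to zero.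
  have hdc : ∀ f : ℂ → ℂ, (∀ z, ‖z‖ ≤ 1 → DifferentiableAt ℂ f z) →
      ∫ θ in (0 : ℝ)..2 * π, f (circleMap 0 1 θ) = 2 * π * f 0 := by
    intro f hf
    have h1 : DiffContOnCl ℂ f (Metric.ball 0 |1|) := by
      refine DifferentiableOn.diffContOnCl fun w hw => (hf w ?_).differentiableWithinAt
      have := Metric.closure_ball_subset_closedBall hw
      simpa using this
    have h2 := h1.circleAverage
    rw [Real.circleAverage_def, inv_smul_eq_iff₀ Real.two_pi_pos.ne'] at h2
    rw [h2, Complex.real_smul, Complex.ofReal_mul, Complex.ofReal_ofNat]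
  have hcirc : ∀ θ : ℝ, ‖circleMap 0 1 θ‖ = 1 := fun θ => by simp
  have hre : ∀ θ : ℝ, F (circleMap 0 1 θ) = ((F (circleMap 0 1 θ)).re : ℂ) := fun θ =>
    Complex.ext rfl ((him _ (hcirc θ)).trans (Complex.ofReal_im _).symm)
  have h0 : F 0 = ((F 0).re : ℂ) := by
    have h1 := hdc F hF
    rw [funext hre] at h1
    rw [intervalIntegral.integral_ofReal] at h1
    have h2 := congrArg Complex.im h1
    rw [Complex.ofReal_im, ← Complex.ofReal_ofNat, ← Complex.ofReal_mul, Complex.im_ofReal_mul] at h2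
    refine Complex.ext rfl ?_
    rw [Complex.ofReal_im]
    exact (mul_eq_zero.1 h2.symm).resolve_left Real.two_pi_pos.ne'
  have hsq := hdc (fun z => (F z - F 0) ^ 2) fun z hz => ((hF z hz).sub_const _).pow 2
  have hcont : Continuous fun θ : ℝ => ((F (circleMap 0 1 θ)).re - (F 0).re) ^ 2 := by
    refine ((Complex.continuous_re.comp ?_).sub continuous_const).pow 2
    rw [continuous_iff_continuousAt]
    intro θ
    exact ((hF _ (hcirc θ).le).continuousAt).comp (continuous_circleMap 0 1).continuousAt
  have hint : ∫ θ in (0 : ℝ)..2 * π, ((F (circleMap 0 1 θ)).re - (F 0).re) ^ 2 = 0 := by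
    have h1 : ∀ θ : ℝ, (F (circleMap 0 1 θ) - F 0) ^ 2
        = ((((F (circleMap 0 1 θ)).re - (F 0).re) ^ 2 : ℝ) : ℂ) := fun θ => by
      rw [hre θ, h0]
      push_cast
      simp
    simp_rw [h1] at hsq
    rw [intervalIntegral.integral_ofReal] at hsq
    simpa using hsq
  by_contra hne
  obtain ⟨θ, hθ, rfl⟩ : ∃ θ ∈ Icc 0 (2 * π), circleMap 0 1 θ = z := by
    have hz' : z ∈ Metric.sphere (0 : ℂ) |1| := by simpa using hz
    rw [← image_circleMap_Ioc] at hz'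
    obtain ⟨θ, hθ, h⟩ := hz'
    exact ⟨θ, ⟨hθ.1.le, hθ.2⟩, h⟩
  have hpos : 0 < ∫ θ in (0 : ℝ)..2 * π, ((F (circleMap 0 1 θ)).re - (F 0).re) ^ 2 := by
    refine intervalIntegral.integral_pos Real.two_pi_pos hcont.continuousOn
      (fun _ _ => sq_nonneg _) ⟨θ, hθ, ?_⟩
    refine lt_of_le_of_ne (sq_nonneg _) (Ne.symm (pow_ne_zero 2 (sub_ne_zero.2 fun h => hne ?_)))
    rw [hre θ, h0, h]
  exact hpos.ne' hint

/-- For real r, 2i times the imaginary part is a polynomial in r whose coefficient in degree twice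
the matrix size is 2i times the quantity in `h`; so it is nonzero and has finitely many roots. -/
theorem finite_im_det_mul_conj_eq_zero {n : Type*} [Fintype n] [DecidableEq n]
    {A₁ A₂ : Matrix n n ℂ} (h : (A₁.det * conj A₂.det).im ≠ 0) (B₁ B₂ : Matrix n n ℂ) :
    {r : ℝ | (((r : ℂ) • A₁ + B₁).det * conj ((r : ℂ) • A₂ + B₂).det).im = 0}.Finite := by
  let p : Matrix n n ℂ → Matrix n n ℂ → Polynomial ℂ := fun A B =>
    ((Polynomial.X : Polynomial ℂ) • A.map Polynomial.C + B.map Polynomial.C).det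
  have hp : ∀ A B (r : ℂ), (p A B).eval r = (r • A + B).det := by
    intro A B r
    have := RingHom.map_det (Polynomial.evalRingHom r)
      ((Polynomial.X : Polynomial ℂ) • A.map Polynomial.C + B.map Polynomial.C)
    simp only [p, Polynomial.coe_evalRingHom] at this ⊢
    rw [this]
    congr 1
    ext i j
    simp only [RingHom.mapMatrix_apply, Matrix.map_apply, Matrix.add_apply, Matrix.smul_apply,
      smul_eq_mul, Polynomial.coe_evalRingHom, Polynomial.eval_add, Polynomial.eval_mul,
      Polynomial.eval_X, Polynomial.eval_C]
  let q : Matrix n n ℂ → Matrix n n ℂ → Polynomial ℂ := fun A B => p (A.map conj) (B.map conj)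
  have hq : ∀ A B (r : ℝ), (q A B).eval (r : ℂ) = conj ((r : ℂ) • A + B).det := by
    intro A B r
    rw [show q A B = p (A.map conj) (B.map conj) from rfl, hp, RingHom.map_det]
    congr 1
    ext i j
    simp
  have hdeg : ∀ A B, (p A B).natDegree ≤ Fintype.card n := fun A B =>
    Polynomial.natDegree_det_X_add_C_le A B
  have hcoeff : ∀ A B, (p A B).coeff (Fintype.card n) = A.det := fun A B =>
    Polynomial.coeff_det_X_add_C_card A B
  have hdc : ∀ A : Matrix n n ℂ, (A.map conj).det = conj A.det := fun A => by
    rw [RingHom.map_det]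
    rfl
  let f : Polynomial ℂ := p A₁ B₁ * q A₂ B₂ - q A₁ B₁ * p A₂ B₂
  have hf : f ≠ 0 := by
    intro h0
    have h1 : f.coeff (Fintype.card n + Fintype.card n) = 0 := by rw [h0, Polynomial.coeff_zero]
    simp only [f, q, Polynomial.coeff_sub] at h1
    rw [Polynomial.coeff_mul_add_eq_of_natDegree_le (hdeg _ _) (hdeg _ _),
      Polynomial.coeff_mul_add_eq_of_natDegree_le (hdeg _ _) (hdeg _ _),
      hcoeff, hcoeff, hcoeff, hcoeff, hdc, hdc] at h1
    have h2 := Complex.sub_conj (A₁.det * conj A₂.det)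
    rw [map_mul, Complex.conj_conj, h1] at h2
    have h3 : ((2 * (A₁.det * conj A₂.det).im : ℝ) : ℂ) = 0 :=
      (mul_eq_zero.1 h2.symm).resolve_right Complex.I_ne_zero
    have h4 : 2 * (A₁.det * conj A₂.det).im = 0 := by exact_mod_cast h3
    exact h (by linarith)
  have hfin : (f.roots.toFinset : Set ℂ).Finite := Finset.finite_toSet _
  refine (hfin.preimage (f := fun r : ℝ => (r : ℂ)) Complex.ofReal_injective.injOn).subset ?_
  intro r hr
  simp only [mem_preimage, Finset.mem_coe, Multiset.mem_toFinset]
  rw [Polynomial.mem_roots hf, Polynomial.IsRoot.def]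
  simp only [f, Polynomial.eval_sub, Polynomial.eval_mul, hq, hp]
  have h2 := Complex.sub_conj (((r : ℂ) • A₁ + B₁).det * conj ((r : ℂ) • A₂ + B₂).det)
  have hr' : (((r : ℂ) • A₁ + B₁).det * conj ((r : ℂ) • A₂ + B₂).det).im = 0 := hr
  rw [map_mul, Complex.conj_conj, hr'] at h2
  rw [h2]
  simp

/-- Fubini: for each fixed first magnitude the exceptional second magnitudes form a finite set. -/
theorem ae_im_det_mul_conj_ne_zero_right {n : Type*} [Fintype n] [DecidableEq n]
    {A₁ A₂ : Matrix n n ℂ} (h : (A₁.det * conj A₂.det).im ≠ 0) (B₁ B₂ Q₁ Q₂ : Matrix n n ℂ) :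
    ∀ᵐ r : ℝ × ℝ, (((r.1 : ℂ) • B₁ + (r.2 : ℂ) • A₁ + Q₁).det *
      conj ((r.1 : ℂ) • B₂ + (r.2 : ℂ) • A₂ + Q₂).det).im ≠ 0 := by
  have hcont : Continuous fun r : ℝ × ℝ => (((r.1 : ℂ) • B₁ + (r.2 : ℂ) • A₁ + Q₁).det *
      conj ((r.1 : ℂ) • B₂ + (r.2 : ℂ) • A₂ + Q₂).det).im := by
    have hd : ∀ B A Q : Matrix n n ℂ,
        Continuous fun r : ℝ × ℝ => ((r.1 : ℂ) • B + (r.2 : ℂ) • A + Q).det := fun B A Q =>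
      Continuous.matrix_det (by fun_prop)
    exact Complex.continuous_im.comp ((hd _ _ _).mul (Complex.continuous_conj.comp (hd _ _ _)))
  have hmeas := (isOpen_ne_fun hcont (continuous_const (y := (0 : ℝ)))).measurableSet
  rw [Measure.volume_eq_prod, Measure.ae_prod_iff_ae_ae hmeas]
  refine Filter.Eventually.of_forall fun r => ?_
  have hfin := finite_im_det_mul_conj_eq_zero h ((r : ℂ) • B₁ + Q₁) ((r : ℂ) • B₂ + Q₂)
  have hcomm : ∀ (s : ℝ) (B A Q : Matrix n n ℂ),
      (r : ℂ) • B + (s : ℂ) • A + Q = (s : ℂ) • A + ((r : ℂ) • B + Q) := fun s B A Q => by abel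
  refine (hfin.countable.ae_notMem volume).mono fun s hs h0 => hs ?_
  simp only [hcomm] at h0
  exact h0

theorem ae_im_det_mul_conj_ne_zero_left {n : Type*} [Fintype n] [DecidableEq n]
    {A₁ A₂ : Matrix n n ℂ} (h : (A₁.det * conj A₂.det).im ≠ 0) (B₁ B₂ Q₁ Q₂ : Matrix n n ℂ) :
    ∀ᵐ r : ℝ × ℝ, (((r.1 : ℂ) • A₁ + (r.2 : ℂ) • B₁ + Q₁).det *
      conj ((r.1 : ℂ) • A₂ + (r.2 : ℂ) • B₂ + Q₂).det).im ≠ 0 := by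
  have h1 := ae_im_det_mul_conj_ne_zero_right h B₁ B₂ Q₁ Q₂
  rw [Measure.volume_eq_prod] at h1 ⊢
  have h2 := (Measure.measurePreserving_swap (μ := (volume : Measure ℝ))
    (ν := (volume : Measure ℝ))).quasiMeasurePreserving.ae h1
  filter_upwards [h2] with r hr
  simpa only [Prod.fst_swap, Prod.snd_swap, add_comm ((r.1 : ℂ) • A₁), add_comm ((r.1 : ℂ) • A₂)]
    using hr

theorem im_mul_conj_ne_zero {κ g₁ g₂ p₁ p₂ : ℂ} (hκ : κ ≠ 0) (hp₁ : 0 < p₁) (hp₂ : 0 < p₂)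
    (h : (g₁ * conj g₂).im ≠ 0) : (κ * g₁ * p₁ * conj (κ * g₂ * p₂)).im ≠ 0 := by
  obtain ⟨a, ha, rfl⟩ : ∃ a : ℝ, 0 < a ∧ (a : ℂ) = p₁ :=
    ⟨p₁.re, (Complex.pos_iff.1 hp₁).1, Complex.ext rfl (Complex.pos_iff.1 hp₁).2⟩
  obtain ⟨b, hb, rfl⟩ : ∃ b : ℝ, 0 < b ∧ (b : ℂ) = p₂ :=
    ⟨p₂.re, (Complex.pos_iff.1 hp₂).1, Complex.ext rfl (Complex.pos_iff.1 hp₂).2⟩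
  have h1 : κ * g₁ * a * conj (κ * g₂ * b)
      = ((Complex.normSq κ * a * b : ℝ) : ℂ) * (g₁ * conj g₂) := by
    simp only [map_mul, Complex.conj_ofReal]
    push_cast
    rw [← Complex.mul_conj]
    ring
  rw [h1, Complex.im_ofReal_mul]
  have := Complex.normSq_pos.2 hκ
  exact mul_ne_zero (by positivity) h

namespace LDM

variable {V : Type*} {M : LDM V}

/-- The determinant of a lifted filter with genuine dynamics does not have constant phase. -/
theorem exists_im_det_liftedFilter_ne_zero (hs : M.IsStable) {T : ℕ} (hT : 0 < T) {i : V}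
    (hi : 1 ≤ (M.a i).natDegree) : ∃ ω₁ ∈ Ico (0 : ℝ) (2 * π), ∃ ω₂ ∈ Ico (0 : ℝ) (2 * π),
      ((M.liftedFilter T i ω₁).det * conj (M.liftedFilter T i ω₂).det).im ≠ 0 := by
  by_contra! hc
  have hTr : (T : ℝ) ≠ 0 := by exact_mod_cast hT.ne'
  have hTc : (T : ℂ) ≠ 0 := by exact_mod_cast hT.ne'
  obtain ⟨ω₂, hω₂, hω₂'⟩ := ((Set.Ico_infinite Real.two_pi_pos).sdiff
    (finite_det_liftedFilter_eq_zero hs T i)).nonempty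
  have hG : (M.liftedFilter T i ω₂).det ≠ 0 := fun h => hω₂' ⟨hω₂, h⟩
  set w := conj (M.liftedFilter T i ω₂).det
  -- At q = exp(-iω/T) the rotated factors run through the alias frequencies, so F interpolates the
  -- determinant holomorphically in the disc. The constant `w` makes F real on the circle and
  -- nonzero at the point belonging to ω₂.
  let F : ℂ → ℂ := fun q => (∏ r : Fin T, M.delayFilter i
    (Complex.exp (-(Complex.I * (2 * π * (r : ℕ) / T : ℝ))) * q)) * w
  have hnorm : ∀ (θ : ℝ) (q : ℂ), ‖Complex.exp (-(Complex.I * θ)) * q‖ = ‖q‖ := fun θ q => by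
    rw [norm_mul, norm_exp_neg_I, one_mul]
  have hFd : ∀ q, ‖q‖ ≤ 1 → DifferentiableAt ℂ F q := by
    intro q hq
    refine DifferentiableAt.mul_const ?_ w
    refine DifferentiableAt.fun_finsetProd fun r _ => ?_
    refine DifferentiableAt.comp q (g := M.delayFilter i) ?_ (by fun_prop)
    exact differentiableAt_delayFilter hs i ((hnorm _ q).trans_le hq)
  have hFG : ∀ ω : ℝ, F (Complex.exp (-(Complex.I * (ω / T : ℝ))))
      = (M.liftedFilter T i ω).det * w := by
    intro ω
    rw [det_liftedFilter hs]
    simp only [F]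
    congr 1
    refine Finset.prod_congr rfl fun r _ => ?_
    rw [response, ← Complex.exp_add]
    congr 2
    unfold aliasFreq
    push_cast
    ring
  have hcircle : ∀ z : ℂ, ‖z‖ = 1 → ∃ ω : ℝ, Complex.exp (-(Complex.I * (ω / T : ℝ))) = z := by
    intro z hz
    refine ⟨-(z.arg * T), ?_⟩
    have := Complex.norm_mul_exp_arg_mul_I z
    rw [hz, Complex.ofReal_one, one_mul] at this
    conv_rhs => rw [← this]
    congr 1
    push_cast
    field_simp
  have him : ∀ z, ‖z‖ = 1 → (F z).im = 0 := by
    intro z hz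
    obtain ⟨ω, rfl⟩ := hcircle z hz
    rw [hFG]
    have hper : Function.Periodic (M.liftedFilter T i) (2 * π) := liftMatrix_periodic T _
    obtain ⟨y, hy, hy'⟩ := hper.exists_mem_Ico₀ Real.two_pi_pos ω
    rw [hy']
    exact hc y hy ω₂ hω₂
  have hconst := fun z hz => eq_center_of_im_eq_zero_on_circle hFd him (z := z) hz
  -- The factor r = 0 vanishes at -1 precisely because the node is genuinely dynamic.
  have h1 : F (-1) = 0 := by
    simp only [F]
    rw [Finset.prod_eq_zero (Finset.mem_univ (⟨0, hT⟩ : Fin T)), zero_mul]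
    rw [delayFilter_eq_zero_iff hs i (by rw [hnorm]; simp)]
    exact ⟨by simp, hi⟩
  have h2 := (hconst _ (norm_exp_neg_I (ω₂ / T))).trans ((hconst (-1) (by simp)).symm.trans h1)
  rw [hFG] at h2
  exact mul_ne_zero hG ((map_ne_zero _).2 hG) h2

variable [DecidableEq V]

/-- The convention 0/0 = 0 keeps absent edges absent, so non-adjacent pairs have no exceptional
magnitudes. -/
theorem setMagnitudes_eq_self {i j : V} (hij : M.b i j = 0) (hji : M.b j i = 0) (r s : ℝ) :
    M.setMagnitudes i j r s = M := by
  obtain ⟨a, dt, hdt, b⟩ := M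
  simp only [setMagnitudes, LDM.mk.injEq, true_and]
  funext k l
  simp only at hij hji
  split_ifs with h1 h2
  · rw [h1.1, h1.2, hij]
    simp
  · rw [h2.1, h2.2, hji]
    simp
  · rfl

variable [Fintype V] {Ω : Type*} [MeasurableSpace Ω] {P : Measure Ω} {τ : V → ℕ}
  {T : ℕ} {e : V → ℤ → Ω → ℂ}

/-- For almost all magnitudes of the weights between adjacent nodes, the phase of their block is
not constant. -/
theorem ae_not_hasConstantPhase (hs : M.IsStable) (hT0 : 0 < T) (hT : ∀ i, τ i ∣ T)
    (he : IsExogenousInput P τ e) (hpsd : HasPSD P T e) (hdet : TopologicallyDetectable P T e)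
    (hdyn : ∀ i, 1 ≤ (M.a i).natDegree) {i j : V} (hij : i ≠ j)
    (hb : M.b i j ≠ 0 ∨ M.b j i ≠ 0) :
    ∀ᵐ r : ℝ × ℝ, (M.setMagnitudes i j r.1 r.2).WellPosed T →
      ∀ x : V → ℤ → Ω → ℂ, (M.setMagnitudes i j r.1 r.2).IsOutput P e x →
        ¬ ∃ c : ℝ, HasConstantPhase (fun ω => block (psd P T x ω)⁻¹ j i) c := by
  let u : V → V → ℂ := fun k l => M.b k l / ‖M.b k l‖
  let A : ℝ → Matrix (Fin T) (Fin T) ℂ := fun ω =>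
    -conj (u i j) • ((M.liftedFilter T i ω).conjTranspose * (block (psd P T e ω) i i)⁻¹)
  let B : ℝ → Matrix (Fin T) (Fin T) ℂ := fun ω =>
    -u j i • ((block (psd P T e ω) j j)⁻¹ * M.liftedFilter T j ω)
  let Q : ℝ → Matrix (Fin T) (Fin T) ℂ := fun ω =>
    ∑ k ∈ (Finset.univ.erase i).erase j, (conj (M.b k j) * M.b k i) •
      ((M.liftedFilter T k ω).conjTranspose * (block (psd P T e ω) k k)⁻¹ * M.liftedFilter T k ω)
  have hblock : ∀ r : ℝ × ℝ, (M.setMagnitudes i j r.1 r.2).WellPosed T →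
      ∀ x : V → ℤ → Ω → ℂ, (M.setMagnitudes i j r.1 r.2).IsOutput P e x → ∀ ω,
        block (psd P T x ω)⁻¹ j i = (r.1 : ℂ) • A ω + (r.2 : ℂ) • B ω + Q ω := by
    intro r hw x hx ω
    have hN : ∀ k, (M.setMagnitudes i j r.1 r.2).liftedFilter T k = M.liftedFilter T k :=
      fun k => rfl
    have hbij : (M.setMagnitudes i j r.1 r.2).b i j = r.1 * u i j := by
      simp [setMagnitudes, u]
    have hbji : (M.setMagnitudes i j r.1 r.2).b j i = r.2 * u j i := by
      simp [setMagnitudes, u, hij, hij.symm]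
    rw [hx.block_psd_inv (M := M.setMagnitudes i j r.1 r.2) hs hT he hpsd hdet hw hij, hbij, hbji]
    simp only [hN]
    congr 1
    · simp only [A, B, map_mul, Complex.conj_ofReal, neg_smul, smul_neg, smul_smul]
      rw [sub_eq_add_neg]
    · refine Finset.sum_congr rfl fun k hk => ?_
      simp only [Finset.mem_erase, Finset.mem_univ, and_true] at hk
      simp [setMagnitudes, hk.1, hk.2]
  have hcase : ∃ ω₁ ∈ Ico (0 : ℝ) (2 * π), ∃ ω₂ ∈ Ico (0 : ℝ) (2 * π),
      ∀ᵐ r : ℝ × ℝ, (((r.1 : ℂ) • A ω₁ + (r.2 : ℂ) • B ω₁ + Q ω₁).det *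
        conj ((r.1 : ℂ) • A ω₂ + (r.2 : ℂ) • B ω₂ + Q ω₂).det).im ≠ 0 := by
    have hu : ∀ {k l}, M.b k l ≠ 0 → u k l ≠ 0 := fun h =>
      div_ne_zero h (by exact_mod_cast norm_ne_zero_iff.2 h)
    rcases hb with hb | hb
    · obtain ⟨ω₁, h₁, ω₂, h₂, h⟩ := exists_im_det_liftedFilter_ne_zero hs hT0 (hdyn i)
      -- The frequencies are swapped because the term of b_ij contains the adjoint of the filter,
      -- which conjugates its determinant.
      refine ⟨ω₂, h₂, ω₁, h₁, ae_im_det_mul_conj_ne_zero_left ?_ _ _ _ _⟩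
      simp only [A, Matrix.det_smul, Matrix.det_mul, Matrix.det_conjTranspose, ← mul_assoc]
      refine im_mul_conj_ne_zero (pow_ne_zero _ (neg_ne_zero.2 ((map_ne_zero _).2 (hu hb))))
        (hdet.posDef i ω₂).inv.det_pos (hdet.posDef i ω₁).inv.det_pos ?_
      rwa [RCLike.star_def, Complex.conj_conj, mul_comm]
    · obtain ⟨ω₁, h₁, ω₂, h₂, h⟩ := exists_im_det_liftedFilter_ne_zero hs hT0 (hdyn j)
      refine ⟨ω₁, h₁, ω₂, h₂, ae_im_det_mul_conj_ne_zero_right ?_ _ _ _ _⟩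
      simp only [B, Matrix.det_smul, Matrix.det_mul, mul_comm (Matrix.det (_)⁻¹), ← mul_assoc]
      exact im_mul_conj_ne_zero (pow_ne_zero _ (neg_ne_zero.2 (hu hb)))
        (hdet.posDef j ω₁).inv.det_pos (hdet.posDef j ω₂).inv.det_pos h
  obtain ⟨ω₁, h₁, ω₂, h₂, hae⟩ := hcase
  filter_upwards [hae] with r hr hw x hx
  rintro ⟨c, hc⟩
  have := hc.im_det_mul_conj_eq_zero h₁ h₂
  simp only [hblock r hw x hx] at this
  exact hr this

/-- Nodes that are neither adjacent nor strict spouses have a vanishing block. -/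
theorem IsOutput.not_hasConstantPhase (hs : M.IsStable) (hT : ∀ i, τ i ∣ T)
    (he : IsExogenousInput P τ e) (hpsd : HasPSD P T e) (hdet : TopologicallyDetectable P T e)
    (hw : M.WellPosed T) {x : V → ℤ → Ω → ℂ} (hx : M.IsOutput P e x) {i j : V} (hij : i ≠ j)
    (hbij : M.b i j = 0) (hbji : M.b j i = 0) (h : ¬ M.StrictSpouses i j) (c : ℝ) :
    ¬ HasConstantPhase (fun ω => block (psd P T x ω)⁻¹ j i) c := by
  rintro ⟨-, ω, -, μ, hμ, hμ0⟩
  have h0 : block (psd P T x ω)⁻¹ j i = 0 := by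
    rw [hx.block_psd_inv hs hT he hpsd hdet hw hij, hbij, hbji]
    simp only [map_zero, zero_smul, neg_zero, sub_zero, zero_add]
    refine Finset.sum_eq_zero fun k hk => ?_
    simp only [Finset.mem_erase, Finset.mem_univ, and_true] at hk
    by_cases hkj : M.b k j = 0
    · simp [hkj]
    by_cases hki : M.b k i = 0
    · simp [hki]
    refine absurd ⟨hij, ⟨k, (edge_iff hs k i).2 ⟨hk.2, hki⟩, (edge_iff hs k j).2 ⟨hk.1, hkj⟩⟩, ?_⟩ h
    rintro (h1 | h1)
    · exact ((edge_iff hs i j).1 h1).2 hbij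
    · exact ((edge_iff hs j i).1 h1).2 hbji
  simp only [h0] at hμ
  rw [spectrum.mem_iff, sub_zero] at hμ
  exact hμ ((isUnit_iff_ne_zero.2 hμ0).map _)

end LDM

end

theorem mainTheorem4 {V : Type*} [Fintype V] [DecidableEq V]
    {Ω : Type*} [MeasurableSpace Ω] (P : Measure Ω) [IsProbabilityMeasure P]
    (M : LDM V) (hstable : M.IsStable) (hphase : M.SameOutgoingPhase)
    (τ : V → ℕ) (T : ℕ) (hT : T = Finset.univ.lcm τ)
    (e : V → ℤ → Ω → ℂ) (he : IsExogenousInput P τ e)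
    (hpsd : HasPSD P T e) (hdet : TopologicallyDetectable P T e) :
    -- the spectral density of the output exists and is invertible, and the block of every pair
    -- of strict spouses has constant phase
    (M.WellPosed T → ∀ x : V → ℤ → Ω → ℂ, M.IsOutput P e x →
      HasPSD P T x ∧ (∀ ω : ℝ, IsUnit (psd P T x ω)) ∧
      ∀ i j : V, M.StrictSpouses i j →
        (∃ c : ℝ, HasConstantPhase (fun ω => block (psd P T x ω)⁻¹ j i) c) ∧
        {ω ∈ Ico (0 : ℝ) (2 * π) | 0 ∈ spectrum ℂ (block (psd P T x ω)⁻¹ j i)}.Finite) ∧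
    -- the equivalence, for almost all magnitudes of the weights `b_{ij}` and `b_{ji}`
    ((∀ i, 1 ≤ (M.a i).natDegree) → ∀ i j : V, i ≠ j →
      ∀ᵐ r : ℝ × ℝ, 0 < r.1 → 0 < r.2 →
        (M.setMagnitudes i j r.1 r.2).WellPosed T →
        ∀ x : V → ℤ → Ω → ℂ, (M.setMagnitudes i j r.1 r.2).IsOutput P e x →
          ((∃ c : ℝ, HasConstantPhase (fun ω => block (psd P T x ω)⁻¹ j i) c) ↔
            (M.setMagnitudes i j r.1 r.2).StrictSpouses i j)) := by
  have hTdvd : ∀ i, τ i ∣ T := fun i => hT ▸ Finset.dvd_lcm (Finset.mem_univ i)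
  have hT0 : 0 < T := by
    refine Nat.pos_of_ne_zero fun h => ?_
    rw [hT, Finset.lcm_eq_zero_iff] at h
    obtain ⟨i, -, hi⟩ := h
    exact (he.wscs i).pos.ne' hi
  refine ⟨fun hw x hx => ⟨(hx.psd_eq hstable hTdvd he hpsd hw).1,
    hx.isUnit_psd hstable hTdvd he hpsd hdet hw, fun i j h =>
      h.hasConstantPhase hstable hphase hT0 hTdvd he hpsd hdet hw hx⟩, fun hdyn i j hij => ?_⟩
  by_cases hb : M.b i j ≠ 0 ∨ M.b j i ≠ 0
  · filter_upwards [LDM.ae_not_hasConstantPhase hstable hT0 hTdvd he hpsd hdet hdyn hij hb]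
      with r hr hr1 hr2 hw x hx
    -- With positive magnitudes the edge persists, so the nodes are adjacent and both sides fail.
    refine iff_of_false (hr hw x hx) fun h => h.2.2 ?_
    have hs : (M.setMagnitudes i j r.1 r.2).IsStable := hstable
    rcases hb with hb | hb
    · refine Or.inl ((LDM.edge_iff hs i j).2 ⟨hij, ?_⟩)
      simp [LDM.setMagnitudes, hb, hr1.ne']
    · refine Or.inr ((LDM.edge_iff hs j i).2 ⟨hij.symm, ?_⟩)
      simp [LDM.setMagnitudes, hb, hr2.ne', hij.symm]
  · push Not at hb
    refine Filter.Eventually.of_forall fun r _ _ => ?_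
    rw [LDM.setMagnitudes_eq_self hb.1 hb.2]
    intro hw x hx
    refine ⟨fun ⟨c, hc⟩ => ?_, fun h =>
      (h.hasConstantPhase hstable hphase hT0 hTdvd he hpsd hdet hw hx).1⟩
    by_contra h
    exact hx.not_hasConstantPhase hstable hTdvd he hpsd hdet hw hij hb.1 hb.2 h c hc
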